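/- Let $\Sigma$ be any rational complete fan in $\mathbb{R}^3$. Then there is a complete unimodular fan $\Sigma'$ in $\mathbb{R}^3$ that refines $\Sigma$ and such that $\Sigma'$ is not a blow-up of any unimodular fan. Moreover, if $\Sigma$ is polytopal, then $\Sigma'$ can be chosen polytopal too. Here a fan is a finite nonempty collection of polyhedral cones, closed under taking faces, in which any two cones meet in a common face. A fan is complete if its cones cover the space, and rational if each of its cones is generated by integer vectors. A complete fan is polytopal if it is the normal fan of a polytope. A rational simplicial cone with primitive generators $\alpha_1,\dots,\alpha_k$ is unimodular if $\alpha_1,\dots,\alpha_k$ generate the lattice of all integer points in their linear span. A fan is unimodular if all its cones are unimodular and it contains a full-dimensional cone. A complete fan $\Sigma'$ refines a complete fan $\Sigma$ if every cone of $\Sigma'$ is contained in a cone of $\Sigma$. The blow-up of a fan $\Sigma_0$ at a unimodular cone $C\in\Sigma_0$ of dimension $k\ge 2$ with primitive generators $\alpha_1,\dots,\alpha_k$ is the stellar subdivision of $\Sigma_0$ by $\gamma=\alpha_1+\cdots+\alpha_k$, that is, the fan consisting of the cones of $\Sigma_0$ that do not contain $\gamma$ and of the cones $\operatorname{Cone}(C_0\cup\{\gamma\})$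 for $C_0\in\Sigma_0$ with $\gamma\notin C_0$ such that some $C'\in\Sigma_0$ contains $C_0\cup\{\gamma\}$. -/

import Mathlib

/-- A polyhedral fan in `ℝⁿ`: a finite (nonempty) complex of polyhedral cones, closed under taking
faces, in which any two cones intersect in a common face. The cones are allowed to have a
nontrivial lineality space. -/
structure PolyhedralFan (n : ℕ) where
  /-- The cones of the fan. -/
  cones : Set (PointedCone ℝ (Fin n → ℝ))
  finite : cones.Finite
  nonempty : cones.Nonempty
  polyhedral : ∀ C ∈ cones, C.FG
  face_mem : ∀ C ∈ cones, ∀ F : PointedCone ℝ (Fin n → ℝ), F.IsFaceOf C → F ∈ cones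
  inf_isFaceOf_left : ∀ C ∈ cones, ∀ D ∈ cones, (C ⊓ D).IsFaceOf C
  inf_isFaceOf_right : ∀ C ∈ cones, ∀ D ∈ cones, (C ⊓ D).IsFaceOf D

namespace PolyhedralFan

/-- The inclusion of the lattice `ℤⁿ` in `ℝⁿ`. -/
def latticeHom (n : ℕ) : (Fin n → ℤ) →+ (Fin n → ℝ) :=
  (Int.castAddHom ℝ).compLeft (Fin n)

/-- An integer vector is primitive if its entries are relatively prime. In particular it is
nonzero. -/
def IsPrimitive {n : ℕ} (v : Fin n → ℤ) : Prop :=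
  Finset.univ.gcd v = 1

/-- A cone is rational if it is generated by finitely many integer vectors. -/
def IsRationalCone {n : ℕ} (C : PointedCone ℝ (Fin n → ℝ)) : Prop :=
  ∃ s : Finset (Fin n → ℤ), C = PointedCone.hull ℝ (latticeHom n '' (s : Set (Fin n → ℤ)))

/-- A cone is full-dimensional if it spans the ambient space linearly. -/
def IsFullDimCone {n : ℕ} (C : PointedCone ℝ (Fin n → ℝ)) : Prop :=
  Submodule.span ℝ (C : Set (Fin n → ℝ)) = ⊤

/-- `α₁, …, α_k` are the primitive generators of the rational simplicial cone `C`: they are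
primitive integer vectors, linearly independent, and they generate `C`. -/
structure IsPrimitiveGenerators {n k : ℕ} (α : Fin k → Fin n → ℤ)
    (C : PointedCone ℝ (Fin n → ℝ)) : Prop where
  primitive : ∀ i, IsPrimitive (α i)
  linearIndependent : LinearIndependent ℝ (fun i => latticeHom n (α i))
  hull_eq : PointedCone.hull ℝ (Set.range fun i => latticeHom n (α i)) = C

/-- The multiplicity of the simplicial cone generated by `α₁, …, α_k`: the index of the lattice
generated by the `α_i` in the lattice of all integer vectors in their real linear span. -/
noncomputable def coneMultiplicity {n k : ℕ} (α : Fin k → Fin n → ℤ) : ℕ :=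
  (AddSubgroup.closure (Set.range α)).relIndex
    ((Submodule.span ℝ (Set.range fun i => latticeHom n (α i))).toAddSubgroup.comap
      (latticeHom n))

/-- `C` is a unimodular (rational, simplicial) cone with primitive generators `α₁, …, α_k`. -/
def IsUnimodularGenerators {n k : ℕ} (α : Fin k → Fin n → ℤ)
    (C : PointedCone ℝ (Fin n → ℝ)) : Prop :=
  IsPrimitiveGenerators α C ∧ coneMultiplicity α = 1

/-- A unimodular cone: a rational simplicial cone of multiplicity one. -/
def IsUnimodularCone {n : ℕ} (C : PointedCone ℝ (Fin n → ℝ)) : Prop :=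
  ∃ (k : ℕ) (α : Fin k → Fin n → ℤ), IsUnimodularGenerators α C

/-- A fan is rational if all of its cones are rational. -/
def IsRational {n : ℕ} (S : PolyhedralFan n) : Prop :=
  ∀ C ∈ S.cones, IsRationalCone C

/-- A fan is complete if its cones cover the space. -/
def IsComplete {n : ℕ} (S : PolyhedralFan n) : Prop :=
  ∀ x : Fin n → ℝ, ∃ C ∈ S.cones, x ∈ C

/-- A unimodular fan: a full-dimensional fan all of whose cones are rational, simplicial and of
multiplicity one. -/
structure IsUnimodular {n : ℕ} (S : PolyhedralFan n) : Prop where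
  fullDim : ∃ C ∈ S.cones, IsFullDimCone C
  unimodular : ∀ C ∈ S.cones, IsUnimodularCone C

/-- `T` refines `S` if every cone of `T` is contained in some cone of `S`. -/
def Refines {n : ℕ} (T S : PolyhedralFan n) : Prop :=
  ∀ D ∈ T.cones, ∃ C ∈ S.cones, D ≤ C

/-- The cones of the stellar subdivision of `S` by the vector `γ`: the cones of `S` that do not
contain `γ`, and the cones generated by `γ` and `C`, for each cone `C` of `S` that does not contain
`γ` but is contained, together with `γ`, in a cone of `S`. -/
def stellarCones {n : ℕ} (S : PolyhedralFan n) (γ : Fin n → ℝ) :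
    Set (PointedCone ℝ (Fin n → ℝ)) :=
  {C | C ∈ S.cones ∧ γ ∉ C} ∪
    {D | ∃ C ∈ S.cones, γ ∉ C ∧ (∃ C' ∈ S.cones, C ≤ C' ∧ γ ∈ C') ∧
      D = PointedCone.hull ℝ (insert γ (C : Set (Fin n → ℝ)))}

/-- `T` is a blow-up of `S`: for some unimodular cone `C` of `S` with primitive generators
`α₁, …, α_k`, `k ≥ 2`, the fan `T` is the stellar subdivision of `S` by `α₁ + ⋯ + α_k`.
(For `k = 1` this stellar subdivision is `S` itself, and for `k = 0` it has no cones.) -/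
def IsBlowUp {n : ℕ} (T S : PolyhedralFan n) : Prop :=
  ∃ C ∈ S.cones, ∃ (k : ℕ) (α : Fin k → Fin n → ℤ), 2 ≤ k ∧ IsUnimodularGenerators α C ∧
    T.cones = S.stellarCones (latticeHom n (∑ i, α i))

/-- The face of `P` in the direction of `a`: the points of `P` at which the linear functional
given by `a` is maximal on `P`. -/
def faceInDirection {n : ℕ} (P : Set (Fin n → ℝ)) (a : Fin n → ℝ) : Set (Fin n → ℝ) :=
  {p ∈ P | ∀ x ∈ P, 0 ≤ a ⬝ᵥ (p - x)}

/-- The normal cone of `F` in `P`, where the dual space is identified with `ℝⁿ` through the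
standard scalar product. -/
def normalCone {n : ℕ} (P F : Set (Fin n → ℝ)) : PointedCone ℝ (Fin n → ℝ) where
  carrier := {a | ∀ p ∈ F, ∀ q ∈ P, 0 ≤ a ⬝ᵥ (p - q)}
  add_mem' := by
    intro a b ha hb p hp q hq
    rw [add_dotProduct]
    exact add_nonneg (ha p hp q hq) (hb p hp q hq)
  zero_mem' := by
    intro p _ q _
    simp
  smul_mem' := by
    intro c a ha p hp q hq
    change 0 ≤ ((c : ℝ) • a) ⬝ᵥ (p - q)
    rw [smul_dotProduct]
    exact mul_nonneg c.2 (ha p hp q hq)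

/-- A fan is polytopal if it is the normal fan of a polytope, that is, if its cones are the normal
cones of the faces of the convex hull of some finite nonempty set of points. -/
def IsPolytopal {n : ℕ} (S : PolyhedralFan n) : Prop :=
  ∃ V : Finset (Fin n → ℝ), V.Nonempty ∧
    S.cones = Set.range fun a : Fin n → ℝ =>
      normalCone (convexHull ℝ (V : Set (Fin n → ℝ)))
        (faceInDirection (convexHull ℝ (V : Set (Fin n → ℝ))) a)

end PolyhedralFan

/-! Every fan constructed here is simplicial. It is recorded by its maximal cones, as integer
matrices whose rows are the generators, together with points `y i`. Among these points, `y i`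
maximises the scalar product with each generator of the `i`-th cone, and `y j` attains the same
value exactly when its cone shares that generator (`IsConvexFan`). This one condition yields both
the fan axioms and polytopality: the fan is the normal fan of the convex hull of the `y i`
(`IsConvexFan.toFan`, `IsConvexFan.toFan_isPolytopal`).

A unimodular refinement of `S` of this kind is obtained from the fan of orthants by stellar
subdivisions, which truncate the polytope (`isConvexFan_stellarGen`). Some of them make every cone
lie on one side of each of finitely many hyperplanes, enough of them to force it into a cone of `S`
(`exists_isConvexFan_refining`). The others lower the multiplicities to one
(`exists_finer_natAbs_det_eq_one`).

Each maximal cone, identified with the nonnegative octant by its lattice basis, is then subdivided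
by one fixed unimodular pattern with ten new rays, all in the interior. Since the boundary is not
subdivided, the patterns fit together. Adding a small multiple of the support function of the
pattern keeps strict convexity (`isConvexFan_substGen`).

Suppose the result is a blow-up at a cone with generators `α a`. Their sum is then a ray
(`exists_row_eq_sum`), and each maximal cone at this ray omits at most one of the `α a`
(`exists_row_eq_or`). So of any two of them, one lies in each maximal cone at the ray. The pattern
is chosen so that no two or three rays with this property around a given ray add up to it, which is
a finite check (`patternVertex_add_ne`). -/

namespace PolyhedralFan
open Matrix Filter Topology

variable {n : ℕ}

/-! ### Coordinates with respect to the rows of an integer matrix -/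

/-- The coordinates of `x` with respect to the rows of `A`. -/
noncomputable def coords (A : Matrix (Fin n) (Fin n) ℤ) : (Fin n → ℝ) →ₗ[ℝ] (Fin n → ℝ) :=
  ((A.map (Int.cast : ℤ → ℝ))⁻¹).vecMulLinear

theorem latticeHom_apply (v : Fin n → ℤ) (i : Fin n) : latticeHom n v i = (v i : ℝ) := rfl

theorem latticeHom_injective : Function.Injective (latticeHom n) := fun v w h => by
  funext i
  have := congrFun h i
  simpa [latticeHom_apply] using this

theorem latticeHom_ne_zero {v : Fin n → ℤ} (hv : v ≠ 0) : latticeHom n v ≠ 0 := fun h =>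
  hv (latticeHom_injective (h.trans (map_zero _).symm))

theorem latticeHom_smul (c : ℤ) (v : Fin n → ℤ) :
    latticeHom n (c • v) = (c : ℝ) • latticeHom n v := by
  funext i
  simp [latticeHom_apply]

theorem latticeHom_dotProduct (u v : Fin n → ℤ) :
    latticeHom n u ⬝ᵥ latticeHom n v = ((u ⬝ᵥ v : ℤ) : ℝ) := by
  simp [dotProduct, latticeHom_apply]

theorem latticeHom_vecMul (c : Fin n → ℤ) (A : Matrix (Fin n) (Fin n) ℤ) :
    latticeHom n (c ᵥ* A) = ∑ k, (c k : ℝ) • latticeHom n (A k) := by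
  rw [vecMul_eq_sum, map_sum]
  exact Finset.sum_congr rfl fun k _ => latticeHom_smul _ _

theorem isUnit_det_map {A : Matrix (Fin n) (Fin n) ℤ} (hA : A.det ≠ 0) :
    IsUnit (A.map (Int.cast : ℤ → ℝ)).det := by
  have : (A.map (Int.cast : ℤ → ℝ)).det = (A.det : ℝ) :=
    ((Int.castRingHom ℝ).map_det A).symm
  rw [this]
  simpa using hA

section coords
variable {A : Matrix (Fin n) (Fin n) ℤ}

theorem sum_coords (hA : A.det ≠ 0) (x : Fin n → ℝ) :
    ∑ k, coords A x k • latticeHom n (A k) = x := by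
  have h : ∑ k, coords A x k • latticeHom n (A k) = coords A x ᵥ* A.map (Int.cast : ℤ → ℝ) :=
    (vecMul_eq_sum _ _).symm
  rw [h, coords, vecMulLinear_apply, vecMul_vecMul, nonsing_inv_mul _ (isUnit_det_map hA),
    vecMul_one]

theorem coords_sum (hA : A.det ≠ 0) (c : Fin n → ℝ) :
    coords A (∑ k, c k • latticeHom n (A k)) = c := by
  have h : ∑ k, c k • latticeHom n (A k) = c ᵥ* A.map (Int.cast : ℤ → ℝ) :=
    (vecMul_eq_sum _ _).symm
  rw [h, coords, vecMulLinear_apply, vecMul_vecMul, mul_nonsing_inv _ (isUnit_det_map hA),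
    vecMul_one]

theorem eq_coords (hA : A.det ≠ 0) {c : Fin n → ℝ} {x : Fin n → ℝ}
    (h : ∑ k, c k • latticeHom n (A k) = x) : coords A x = c := by
  rw [← h, coords_sum hA]

theorem coords_injective (hA : A.det ≠ 0) : Function.Injective (coords A) := fun x y h => by
  rw [← sum_coords hA x, ← sum_coords hA y, h]

theorem coords_row (hA : A.det ≠ 0) (k : Fin n) :
    coords A (latticeHom n (A k)) = Pi.single k 1 :=
  eq_coords hA (by simp [Pi.single_apply])

theorem coords_latticeHom_vecMul (hA : A.det ≠ 0) (c : Fin n → ℤ) :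
    coords A (latticeHom n (c ᵥ* A)) = latticeHom n c := by
  rw [latticeHom_vecMul]
  exact coords_sum hA _

theorem row_injective (hA : A.det ≠ 0) : Function.Injective A := fun k l h => by
  have := coords_row hA k
  rw [h, coords_row hA l] at this
  by_contra hne
  have h1 := congrFun this k
  simp [hne] at h1

theorem vecMul_injective_of_det_ne_zero (hA : A.det ≠ 0) :
    Function.Injective fun c : Fin n → ℤ => c ᵥ* A := fun c d h => by
  apply latticeHom_injective
  have := congrArg (fun v => coords A (latticeHom n v)) h
  simpa only [coords_latticeHom_vecMul hA] using this

theorem dotProduct_eq_sum_coords (hA : A.det ≠ 0) (y x : Fin n → ℝ) :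
    y ⬝ᵥ x = ∑ k, coords A x k * (y ⬝ᵥ latticeHom n (A k)) := by
  conv_lhs => rw [← sum_coords hA x]
  simp [dotProduct_sum, dotProduct_smul]

theorem linearIndependent_rows (hA : A.det ≠ 0) :
    LinearIndependent ℝ fun k => latticeHom n (A k) := by
  rw [Fintype.linearIndependent_iff]
  intro c hc k
  have := eq_coords hA hc
  rw [map_zero] at this
  exact (congrFun this k).symm

/-- The coordinates after replacing the `k`-th generator by `γ`. -/
theorem coords_updateRow {k : Fin n} {γ : Fin n → ℤ} (hA : A.det ≠ 0)
    (hA' : (A.updateRow k γ).det ≠ 0) (hk : coords A (latticeHom n γ) k ≠ 0)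
    (x : Fin n → ℝ) (m : Fin n) :
    coords (A.updateRow k γ) x m = if m = k then coords A x k / coords A (latticeHom n γ) k else
      coords A x m - coords A x k / coords A (latticeHom n γ) k * coords A (latticeHom n γ) m := by
  set G := coords A (latticeHom n γ) with hG
  set t := coords A x k / G k with ht
  refine congrFun (eq_coords hA' (c := fun m => if m = k then t else
      coords A x m - t * G m) ?_) m
  conv_rhs => rw [← sum_coords hA x]
  have h1 : latticeHom n γ = ∑ k, G k • latticeHom n (A k) := (sum_coords hA _).symm
  rw [← Finset.add_sum_erase _ _ (Finset.mem_univ k)]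
  have h2 : ∑ m ∈ Finset.univ.erase k, (if m = k then t else coords A x m - t * G m) •
      latticeHom n (A.updateRow k γ m) =
      ∑ m ∈ Finset.univ.erase k, (coords A x m - t * G m) • latticeHom n (A m) := by
    refine Finset.sum_congr rfl fun m hm => ?_
    have hmk := Finset.ne_of_mem_erase hm
    rw [if_neg hmk, updateRow_ne hmk]
  rw [h2, if_pos rfl, updateRow_self, h1]
  have h3 : (coords A x k - t * G k) • latticeHom n (A k) = 0 := by
    rw [ht, div_mul_cancel₀ _ hk, sub_self, zero_smul]
  rw [← zero_add (∑ m ∈ Finset.univ.erase k, (coords A x m - t * G m) • latticeHom n (A m)), ← h3,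
    Finset.add_sum_erase _ (fun m => (coords A x m - t * G m) • latticeHom n (A m))
      (Finset.mem_univ k)]
  simp only [sub_smul, Finset.sum_sub_distrib, mul_smul, ← Finset.smul_sum]
  abel

/-- Cramer's rule: when `γ` is expanded in the rows of `A`, only the `k`-th term contributes to the
determinant. -/
theorem det_updateRow_eq (hA : A.det ≠ 0) (k : Fin n) (γ : Fin n → ℤ) :
    ((A.updateRow k γ).det : ℝ) = coords A (latticeHom n γ) k * A.det := by
  have h1 : ((A.updateRow k γ).det : ℝ) = ((A.updateRow k γ).map (Int.cast : ℤ → ℝ)).det :=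
    (Int.castRingHom ℝ).map_det _
  have h2 : (A.det : ℝ) = (A.map (Int.cast : ℤ → ℝ)).det := (Int.castRingHom ℝ).map_det _
  have h3 : (A.updateRow k γ).map (Int.cast : ℤ → ℝ) = (A.map (Int.cast : ℤ → ℝ)).updateRow k
      (∑ m, coords A (latticeHom n γ) m • (A.map (Int.cast : ℤ → ℝ)) m) := by
    have : (∑ m, coords A (latticeHom n γ) m • (A.map (Int.cast : ℤ → ℝ)) m) = latticeHom n γ :=
      sum_coords hA _
    rw [this, map_updateRow]
    rfl
  rw [h1, h2, h3, det_updateRow_sum]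
  rfl

theorem det_updateRow_ne_zero (hA : A.det ≠ 0) {k : Fin n} {γ : Fin n → ℤ}
    (hk : coords A (latticeHom n γ) k ≠ 0) : (A.updateRow k γ).det ≠ 0 := by
  have := det_updateRow_eq hA k γ
  rw [← Int.cast_ne_zero (α := ℝ), this]
  exact mul_ne_zero hk (Int.cast_ne_zero.2 hA)

end coords

/-! ### Simplicial fans with a strictly convex support function -/

/-- The maximal cones of a complete simplicial fan with a strictly convex support function: each
member of the family lists the generators of one cone, and `y i` is the vertex of the dual polytope
that belongs to the `i`-th cone. -/
structure IsConvexFan {ι : Type} (g : ι → Matrix (Fin n) (Fin n) ℤ) : Prop where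
  det_ne_zero : ∀ i, (g i).det ≠ 0
  cover : ∀ x : Fin n → ℝ, ∃ i, 0 ≤ coords (g i) x
  convex : ∃ y : ι → Fin n → ℝ,
    (∀ i j k l, g i k = g j l → y j ⬝ᵥ latticeHom n (g i k) = y i ⬝ᵥ latticeHom n (g i k)) ∧
    (∀ i j k, (∀ l, g j l ≠ g i k) → y j ⬝ᵥ latticeHom n (g i k) < y i ⬝ᵥ latticeHom n (g i k))

/-- Every cone of `g'` lies in a cone of `g`. -/
def Finer {ι ι' : Type} (g' : ι' → Matrix (Fin n) (Fin n) ℤ) (g : ι → Matrix (Fin n) (Fin n) ℤ) :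
    Prop :=
  ∀ i', ∃ i, ∀ k, 0 ≤ coords (g i) (latticeHom n (g' i' k))

theorem coords_nonneg_of_rows {A B : Matrix (Fin n) (Fin n) ℤ} (hB : B.det ≠ 0)
    (h : ∀ k, 0 ≤ coords A (latticeHom n (B k))) {x : Fin n → ℝ} (hx : 0 ≤ coords B x) :
    0 ≤ coords A x := by
  rw [← sum_coords hB x, map_sum]
  refine Finset.sum_nonneg fun k _ => ?_
  rw [map_smul]
  exact smul_nonneg (hx k) (h k)

section convex
variable {ι : Type} {g : ι → Matrix (Fin n) (Fin n) ℤ} {y : ι → Fin n → ℝ}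

theorem dotProduct_row_le
    (h1 : ∀ i j k l, g i k = g j l → y j ⬝ᵥ latticeHom n (g i k) = y i ⬝ᵥ latticeHom n (g i k))
    (h2 : ∀ i j k, (∀ l, g j l ≠ g i k) →
      y j ⬝ᵥ latticeHom n (g i k) < y i ⬝ᵥ latticeHom n (g i k)) (i j : ι) (k : Fin n) :
    y j ⬝ᵥ latticeHom n (g i k) ≤ y i ⬝ᵥ latticeHom n (g i k) := by
  by_cases h : ∃ l, g j l = g i k
  · obtain ⟨l, hl⟩ := h
    exact (h1 i j k l hl.symm).le
  · push Not at h
    exact (h2 i j k h).le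

theorem dotProduct_le (hdet : ∀ i, (g i).det ≠ 0)
    (h1 : ∀ i j k l, g i k = g j l → y j ⬝ᵥ latticeHom n (g i k) = y i ⬝ᵥ latticeHom n (g i k))
    (h2 : ∀ i j k, (∀ l, g j l ≠ g i k) →
      y j ⬝ᵥ latticeHom n (g i k) < y i ⬝ᵥ latticeHom n (g i k)) {i : ι} (j : ι)
    {x : Fin n → ℝ} (hx : 0 ≤ coords (g i) x) : y j ⬝ᵥ x ≤ y i ⬝ᵥ x := by
  rw [dotProduct_eq_sum_coords (hdet i) (y j), dotProduct_eq_sum_coords (hdet i) (y i)]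
  exact Finset.sum_le_sum fun k _ =>
    mul_le_mul_of_nonneg_left (dotProduct_row_le h1 h2 i j k) (hx k)

/-- The two scalar products are compared generator by generator; a generator of positive weight that
is missing from the `j`-th cone would make the inequality strict. -/
theorem exists_row_of_dotProduct_eq (hdet : ∀ i, (g i).det ≠ 0)
    (h1 : ∀ i j k l, g i k = g j l → y j ⬝ᵥ latticeHom n (g i k) = y i ⬝ᵥ latticeHom n (g i k))
    (h2 : ∀ i j k, (∀ l, g j l ≠ g i k) →
      y j ⬝ᵥ latticeHom n (g i k) < y i ⬝ᵥ latticeHom n (g i k)) {i j : ι}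
    {x : Fin n → ℝ} (hx : 0 ≤ coords (g i) x) (h : y j ⬝ᵥ x = y i ⬝ᵥ x) (k : Fin n)
    (hk : 0 < coords (g i) x k) : ∃ l, g j l = g i k := by
  by_contra hne
  push Not at hne
  refine absurd h (ne_of_lt ?_)
  rw [dotProduct_eq_sum_coords (hdet i) (y j), dotProduct_eq_sum_coords (hdet i) (y i)]
  exact Finset.sum_lt_sum (fun k _ =>
    mul_le_mul_of_nonneg_left (dotProduct_row_le h1 h2 i j k) (hx k))
    ⟨k, Finset.mem_univ k, mul_lt_mul_of_pos_left (h2 i j k hne) hk⟩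

/-- If every generator occurring in `x` is a row of `B`, the coordinates with respect to `B` are
those with respect to `A`. -/
theorem coords_of_rows {A B : Matrix (Fin n) (Fin n) ℤ} (hA : A.det ≠ 0) (hB : B.det ≠ 0)
    {x : Fin n → ℝ} (h : ∀ k, coords A x k ≠ 0 → ∃ l, B l = A k) (l : Fin n) :
    coords B x l = ∑ k, if B l = A k then coords A x k else 0 := by
  refine congrFun (eq_coords hB (c := fun l => ∑ k, if B l = A k then coords A x k else 0) ?_) l
  conv_rhs => rw [← sum_coords hA x]
  simp only [Finset.sum_smul]
  rw [Finset.sum_comm]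
  refine Finset.sum_congr rfl fun k _ => ?_
  by_cases hk : coords A x k = 0
  · simp [hk]
  · obtain ⟨l, hl⟩ := h k hk
    rw [Finset.sum_eq_single l]
    · rw [if_pos hl, hl]
    · intro m _ hm
      rw [if_neg fun h => hm (row_injective hB (h.trans hl.symm)), zero_smul]
    · simp

theorem coords_eq_of_row_eq {A B : Matrix (Fin n) (Fin n) ℤ} (hA : A.det ≠ 0) (hB : B.det ≠ 0)
    {x : Fin n → ℝ} (h : ∀ k, coords A x k ≠ 0 → ∃ l, B l = A k) {k l : Fin n}
    (hkl : B l = A k) : coords B x l = coords A x k := by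
  rw [coords_of_rows hA hB h, Finset.sum_eq_single k]
  · rw [if_pos hkl]
  · intro m _ hm
    rw [if_neg fun h => hm (row_injective hA (h.symm.trans hkl))]
  · simp

theorem coords_nonneg_of_support {A B : Matrix (Fin n) (Fin n) ℤ} (hA : A.det ≠ 0)
    (hB : B.det ≠ 0) {x : Fin n → ℝ} (hx : 0 ≤ coords A x)
    (h : ∀ k, 0 < coords A x k → ∃ l, B l = A k) : 0 ≤ coords B x := by
  intro l
  rw [coords_of_rows hA hB fun k hk => h k (lt_of_le_of_ne (hx k) hk.symm)]
  refine Finset.sum_nonneg fun k _ => ?_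
  split_ifs
  exacts [hx k, le_rfl]

/-- This is the fan property in coordinates. At a common point both `y i` and `y j` are maximal, so
their values agree, and every generator that really occurs is shared. -/
theorem IsConvexFan.exists_row (hg : IsConvexFan g) {i j : ι} {x : Fin n → ℝ}
    (hi : 0 ≤ coords (g i) x) (hj : 0 ≤ coords (g j) x) {k : Fin n} (hk : 0 < coords (g i) x k) :
    ∃ l, g j l = g i k ∧ coords (g j) x l = coords (g i) x k := by
  obtain ⟨y, h1, h2⟩ := hg.convex
  have heq : y j ⬝ᵥ x = y i ⬝ᵥ x :=
    le_antisymm (dotProduct_le hg.det_ne_zero h1 h2 j hi) (dotProduct_le hg.det_ne_zero h1 h2 i hj)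
  have h := exists_row_of_dotProduct_eq hg.det_ne_zero h1 h2 hi heq
  obtain ⟨l, hl⟩ := h k hk
  exact ⟨l, hl, coords_eq_of_row_eq (hg.det_ne_zero i) (hg.det_ne_zero j)
    (fun k hk => h k (lt_of_le_of_ne (hi k) hk.symm)) hl⟩

theorem IsConvexFan.exists_row_of_ne (hg : IsConvexFan g) {i j : ι} {x : Fin n → ℝ}
    (hi : 0 ≤ coords (g i) x) (hj : 0 ≤ coords (g j) x) {k : Fin n} (hk : coords (g i) x k ≠ 0) :
    ∃ l, g j l = g i k ∧ coords (g j) x l = coords (g i) x k :=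
  hg.exists_row hi hj (lt_of_le_of_ne (hi k) hk.symm)

theorem Finer.refl (hg : ∀ i, (g i).det ≠ 0) : Finer g g := fun i => ⟨i, fun k => by
  rw [coords_row (hg i)]
  exact Pi.single_nonneg.2 zero_le_one⟩

theorem Finer.trans {ι' ι'' : Type} {g' : ι' → Matrix (Fin n) (Fin n) ℤ}
    {g'' : ι'' → Matrix (Fin n) (Fin n) ℤ} (hg' : ∀ i, (g' i).det ≠ 0) (h : Finer g'' g')
    (h' : Finer g' g) : Finer g'' g := fun i => by
  obtain ⟨j, hj⟩ := h i
  obtain ⟨l, hl⟩ := h' j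
  exact ⟨l, fun k => coords_nonneg_of_rows (hg' j) hl (hj k)⟩

end convex

/-! ### Stellar subdivision -/

section stellar
variable {ι : Type}

/-- The index set of the stellar subdivision at `γ`: the cones that do not contain `γ`, and the
cones containing `γ` together with a generator to be replaced by `γ`. -/
def StellarIndex (g : ι → Matrix (Fin n) (Fin n) ℤ) (γ : Fin n → ℤ) : Type :=
  {p : ι × Option (Fin n) // (p.2 = none ∧ ¬ 0 ≤ coords (g p.1) (latticeHom n γ)) ∨
    ∃ k, p.2 = some k ∧ 0 ≤ coords (g p.1) (latticeHom n γ) ∧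
      0 < coords (g p.1) (latticeHom n γ) k}

/-- The matrix `A` with the row given by the second argument, if any, replaced by `γ`. -/
def replaceRow (A : Matrix (Fin n) (Fin n) ℤ) (γ : Fin n → ℤ) :
    Option (Fin n) → Matrix (Fin n) (Fin n) ℤ
  | none => A
  | some k => A.updateRow k γ

/-- The maximal cones of the stellar subdivision at `γ`. -/
def stellarGen (g : ι → Matrix (Fin n) (Fin n) ℤ) (γ : Fin n → ℤ) (p : StellarIndex g γ) :
    Matrix (Fin n) (Fin n) ℤ :=
  replaceRow (g p.1.1) γ p.1.2

instance [Finite ι] (g : ι → Matrix (Fin n) (Fin n) ℤ) (γ : Fin n → ℤ) :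
    Finite (StellarIndex g γ) := by
  unfold StellarIndex
  infer_instance

variable {g : ι → Matrix (Fin n) (Fin n) ℤ} {γ : Fin n → ℤ}

theorem StellarIndex.cases {motive : StellarIndex g γ → Prop} (p : StellarIndex g γ)
    (old : ∀ i (h : ¬ 0 ≤ coords (g i) (latticeHom n γ)), motive ⟨(i, none), Or.inl ⟨rfl, h⟩⟩)
    (new : ∀ i k (h : 0 ≤ coords (g i) (latticeHom n γ))
      (hk : 0 < coords (g i) (latticeHom n γ) k),
      motive ⟨(i, some k), Or.inr ⟨k, rfl, h, hk⟩⟩) : motive p := by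
  obtain ⟨⟨i, o⟩, h⟩ := p
  rcases h with ⟨h1, h2⟩ | ⟨k, h1, h2, h3⟩
  · cases h1
    exact old i h2
  · cases h1
    exact new i k h2 h3

theorem stellarGen_det_ne_zero (hg : ∀ i, (g i).det ≠ 0) (p : StellarIndex g γ) :
    (stellarGen g γ p).det ≠ 0 := by
  induction p using StellarIndex.cases with
  | old i h => exact hg i
  | new i k h hk => exact det_updateRow_ne_zero (hg i) hk.ne'

theorem stellarGen_finer (hg : ∀ i, (g i).det ≠ 0) : Finer (stellarGen g γ) g := fun p => by
  induction p using StellarIndex.cases with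
  | old i h =>
    refine ⟨i, fun k => ?_⟩
    change 0 ≤ coords (g i) (latticeHom n (g i k))
    rw [coords_row (hg i)]
    exact Pi.single_nonneg.2 zero_le_one
  | new i k h hk =>
    refine ⟨i, fun m => ?_⟩
    change 0 ≤ coords (g i) (latticeHom n ((g i).updateRow k γ m))
    by_cases hm : m = k
    · subst hm
      rwa [updateRow_self]
    · rw [updateRow_ne hm, coords_row (hg i)]
      exact Pi.single_nonneg.2 zero_le_one

theorem stellarGen_cover (hg : IsConvexFan g) (hγ : γ ≠ 0) (x : Fin n → ℝ) :
    ∃ p, 0 ≤ coords (stellarGen g γ p) x := by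
  obtain ⟨i, hi⟩ := hg.cover x
  by_cases h : 0 ≤ coords (g i) (latticeHom n γ)
  swap
  · exact ⟨⟨(i, none), Or.inl ⟨rfl, h⟩⟩, hi⟩
  set G := coords (g i) (latticeHom n γ) with hG
  have hne : (Finset.univ.filter fun k => 0 < G k).Nonempty := by
    by_contra hcon
    rw [Finset.not_nonempty_iff_eq_empty, Finset.filter_eq_empty_iff] at hcon
    refine latticeHom_ne_zero hγ (coords_injective (hg.det_ne_zero i) ?_)
    rw [map_zero]
    funext k
    exact le_antisymm (not_lt.1 (hcon (Finset.mem_univ k))) (h k)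
  -- The least ratio is the largest multiple of `γ` that can be subtracted from `x` without leaving
  -- the cone; the generator whose coefficient vanishes then is the one to replace.
  obtain ⟨k, hk, hmin⟩ := Finset.exists_min_image _ (fun k => coords (g i) x k / G k) hne
  simp only [Finset.mem_filter, Finset.mem_univ, true_and] at hk hmin
  refine ⟨⟨(i, some k), Or.inr ⟨k, rfl, h, hk⟩⟩, fun m => ?_⟩
  change 0 ≤ coords ((g i).updateRow k γ) x m
  rw [coords_updateRow (hg.det_ne_zero i) (det_updateRow_ne_zero (hg.det_ne_zero i) hk.ne') hk.ne']
  split_ifs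
  · exact div_nonneg (hi k) hk.le
  · rw [sub_nonneg, ← hG]
    rcases (h m).eq_or_lt with h0 | h0
    · have h0' : G m = 0 := h0.symm
      rw [h0', mul_zero]
      exact hi m
    · have := hmin m h0
      rwa [le_div_iff₀ h0] at this

/-- The vertex of the dual polytope that belongs to a cone of the stellar subdivision. -/
noncomputable def stellarVertex (g : ι → Matrix (Fin n) (Fin n) ℤ) (γ : Fin n → ℤ)
    (y : ι → Fin n → ℝ) (ε : ℝ) (p : StellarIndex g γ) : Fin n → ℝ :=
  match p.1.2 with
  | none => y p.1.1
  | some k => y p.1.1 - (ε / coords (g p.1.1) (latticeHom n γ) k) •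
      fun m => coords (g p.1.1) (Pi.single m 1) k

theorem coords_dotProduct (A : Matrix (Fin n) (Fin n) ℤ) (k : Fin n) (x : Fin n → ℝ) :
    (fun m => coords A (Pi.single m 1) k) ⬝ᵥ x = coords A x k := by
  conv_rhs => rw [pi_eq_sum_univ' x]
  simp [dotProduct, map_sum, map_smul, mul_comm, Finset.sum_apply]

/-- Dually, the face of the polytope in direction `γ` is cut off at depth `ε`: the support function
drops by `ε` at `γ` and keeps its values at the other rays. -/
theorem isConvexFan_stellarGen [Finite ι] (hg : IsConvexFan g) (hγ : γ ≠ 0) :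
    IsConvexFan (stellarGen g γ) := by
  refine ⟨stellarGen_det_ne_zero hg.det_ne_zero, stellarGen_cover hg hγ, ?_⟩
  obtain ⟨y, h1, h2⟩ := hg.convex
  have hdet := hg.det_ne_zero
  have hev : ∀ (a b c : ℝ), a < c → ∀ᶠ ε in 𝓝[>] (0 : ℝ), a - ε * b < c := fun a b c hac => by
    have : Tendsto (fun ε : ℝ => a - ε * b) (𝓝[>] 0) (𝓝 (a - 0 * b)) :=
      ((continuous_const.sub (continuous_id.mul continuous_const)).tendsto 0).mono_left
        nhdsWithin_le_nhds
    exact this.eventually (gt_mem_nhds (by simpa using hac))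
  have hev' : ∀ (a b c : ℝ), a < c → ∀ᶠ ε in 𝓝[>] (0 : ℝ), a < c - ε * b := fun a b c hac => by
    have : Tendsto (fun ε : ℝ => c - ε * b) (𝓝[>] 0) (𝓝 (c - 0 * b)) :=
      ((continuous_const.sub (continuous_id.mul continuous_const)).tendsto 0).mono_left
        nhdsWithin_le_nhds
    exact this.eventually (lt_mem_nhds (by simpa using hac))
  -- Two smallness conditions on `ε`: the strict inequalities at old rays survive the correction of
  -- the vertices, and those at `γ` survive the drop by `ε`.
  have e1 : ∀ᶠ ε in 𝓝[>] (0 : ℝ), ∀ i j k l, (∀ m, g j m ≠ g i k) →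
      y j ⬝ᵥ latticeHom n (g i k) - ε * ((coords (g j) (latticeHom n γ) l)⁻¹ *
        coords (g j) (latticeHom n (g i k)) l) < y i ⬝ᵥ latticeHom n (g i k) := by
    simp only [eventually_all]
    exact fun i j k l h => hev _ _ _ (h2 i j k h)
  have e2 : ∀ᶠ ε in 𝓝[>] (0 : ℝ), ∀ i j, y j ⬝ᵥ latticeHom n γ < y i ⬝ᵥ latticeHom n γ →
      y j ⬝ᵥ latticeHom n γ < y i ⬝ᵥ latticeHom n γ - ε * 1 := by
    simp only [eventually_all]
    exact fun i j h => hev' _ _ _ h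
  obtain ⟨ε, ⟨he1, he2⟩, hε⟩ := ((e1.and e2).and self_mem_nhdsWithin).exists
  replace hε : 0 < ε := hε
  have hnone : ∀ i h, stellarVertex g γ y ε ⟨(i, none), h⟩ = y i := fun _ _ => rfl
  have hsome : ∀ i k h x, stellarVertex g γ y ε ⟨(i, some k), h⟩ ⬝ᵥ x =
      y i ⬝ᵥ x - ε * ((coords (g i) (latticeHom n γ) k)⁻¹ * coords (g i) x k) := fun i k h x => by
    change (y i - (ε / coords (g i) (latticeHom n γ) k) •
      fun m => coords (g i) (Pi.single m 1) k) ⬝ᵥ x = _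
    rw [sub_dotProduct, smul_dotProduct, coords_dotProduct, smul_eq_mul]
    ring
  have hsomeγ : ∀ i k h, 0 < coords (g i) (latticeHom n γ) k →
      stellarVertex g γ y ε ⟨(i, some k), h⟩ ⬝ᵥ latticeHom n γ =
      y i ⬝ᵥ latticeHom n γ - ε * 1 := fun i k h hk => by
    rw [hsome, inv_mul_cancel₀ hk.ne']
  have hsame : ∀ i m k, m ≠ k → coords (g i) (latticeHom n (g i m)) k = 0 := fun i m k hmk => by
    rw [coords_row (hdet i), Pi.single_eq_of_ne hmk.symm]
  have hin : ∀ i m, 0 ≤ coords (g i) (latticeHom n (g i m)) := fun i m => by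
    rw [coords_row (hdet i)]
    exact Pi.single_nonneg.2 zero_le_one
  -- a row of an unchanged cone, or a remaining row of a changed one, is not `γ`
  have hneγ : ∀ i k m, m ≠ k → 0 < coords (g i) (latticeHom n γ) k → g i m ≠ γ :=
    fun i k m hmk hk h => by
      rw [← h, hsame i m k hmk] at hk
      exact lt_irrefl _ hk
  have hneγ' : ∀ i m, ¬ 0 ≤ coords (g i) (latticeHom n γ) → g i m ≠ γ := fun i m h h' =>
    h (h' ▸ hin i m)
  have hγlt : ∀ i j, 0 ≤ coords (g i) (latticeHom n γ) → ¬ 0 ≤ coords (g j) (latticeHom n γ) →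
      y j ⬝ᵥ latticeHom n γ < y i ⬝ᵥ latticeHom n γ := fun i j hi hj => by
    refine lt_of_le_of_ne (dotProduct_le hdet h1 h2 j hi) fun h => hj ?_
    exact coords_nonneg_of_support (hdet i) (hdet j) hi
      (exists_row_of_dotProduct_eq hdet h1 h2 hi h)
  have hγeq : ∀ i j, 0 ≤ coords (g i) (latticeHom n γ) → 0 ≤ coords (g j) (latticeHom n γ) →
      y j ⬝ᵥ latticeHom n γ = y i ⬝ᵥ latticeHom n γ := fun i j hi hj =>
    le_antisymm (dotProduct_le hdet h1 h2 j hi) (dotProduct_le hdet h1 h2 i hj)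
  have keyγ : ∀ i k (h : 0 ≤ coords (g i) (latticeHom n γ))
      (hk : 0 < coords (g i) (latticeHom n γ) k) (q : StellarIndex g γ),
      ((∃ l, stellarGen g γ q l = γ) → stellarVertex g γ y ε q ⬝ᵥ latticeHom n γ =
        y i ⬝ᵥ latticeHom n γ - ε * 1) ∧
      ((∀ l, stellarGen g γ q l ≠ γ) → stellarVertex g γ y ε q ⬝ᵥ latticeHom n γ <
        y i ⬝ᵥ latticeHom n γ - ε * 1) := fun i k h hk q => by
    induction q using StellarIndex.cases with
    | old j hj =>
      refine ⟨fun ⟨l, hl⟩ => absurd hl (hneγ' j l hj), fun _ => ?_⟩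
      rw [hnone]
      exact he2 i j (hγlt i j h hj)
    | new j l hj hl =>
      refine ⟨fun _ => ?_, fun h' => absurd (updateRow_self) (h' l)⟩
      rw [hsomeγ _ _ _ hl, hγeq i j h hj]
  -- The correction to `y j` vanishes at the generators that are kept and is negative at the one
  -- that is replaced; rays outside the old cone are handled by `he1`.
  have keyv : ∀ i m, g i m ≠ γ → ∀ q : StellarIndex g γ,
      ((∃ l, stellarGen g γ q l = g i m) → stellarVertex g γ y ε q ⬝ᵥ latticeHom n (g i m) =
        y i ⬝ᵥ latticeHom n (g i m)) ∧
      ((∀ l, stellarGen g γ q l ≠ g i m) → stellarVertex g γ y ε q ⬝ᵥ latticeHom n (g i m) <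
        y i ⬝ᵥ latticeHom n (g i m)) := fun i m hm q => by
    induction q using StellarIndex.cases with
    | old j hj =>
      rw [hnone]
      exact ⟨fun ⟨l, hl⟩ => h1 i j m l hl.symm, h2 i j m⟩
    | new j l hj hl =>
      rw [hsome]
      refine ⟨fun ⟨r, hr⟩ => ?_, fun h => ?_⟩
      · change (g j).updateRow l γ r = _ at hr
        by_cases hrl : r = l
        · rw [hrl, updateRow_self] at hr
          exact absurd hr.symm hm
        · rw [updateRow_ne hrl] at hr
          rw [h1 i j m r hr.symm, ← hr, hsame j r l hrl]
          simp
      · by_cases hex : ∃ r, g j r = g i m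
        · obtain ⟨r, hr⟩ := hex
          have hrl : r = l := by
            by_contra hrl
            refine h r ?_
            change (g j).updateRow l γ r = _
            rw [updateRow_ne hrl, hr]
          rw [h1 i j m r hr.symm, ← hr, hrl, coords_row (hdet j), Pi.single_eq_same, mul_one,
            sub_lt_self_iff]
          exact mul_pos hε (inv_pos.2 hl)
        · push Not at hex
          exact he1 i j m l hex
  have key : ∀ p q : StellarIndex g γ, ∀ m,
      ((∃ l, stellarGen g γ q l = stellarGen g γ p m) →
        stellarVertex g γ y ε q ⬝ᵥ latticeHom n (stellarGen g γ p m) =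
        stellarVertex g γ y ε p ⬝ᵥ latticeHom n (stellarGen g γ p m)) ∧
      ((∀ l, stellarGen g γ q l ≠ stellarGen g γ p m) →
        stellarVertex g γ y ε q ⬝ᵥ latticeHom n (stellarGen g γ p m) <
        stellarVertex g γ y ε p ⬝ᵥ latticeHom n (stellarGen g γ p m)) := fun p q m => by
    induction p using StellarIndex.cases with
    | old i hi => exact keyv i m (hneγ' i m hi) q
    | new i k hi hk =>
      by_cases hm : m = k
      · have : stellarGen g γ ⟨(i, some k), Or.inr ⟨k, rfl, hi, hk⟩⟩ m = γ := by
          rw [hm]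
          exact updateRow_self
        rw [this, hsomeγ _ _ _ hk]
        exact keyγ i k hi hk q
      · have : stellarGen g γ ⟨(i, some k), Or.inr ⟨k, rfl, hi, hk⟩⟩ m = g i m :=
          updateRow_ne hm
        rw [this, hsome, hsame i m k hm, mul_zero, mul_zero, sub_zero]
        exact keyv i m (hneγ i k m hm hk) q
  exact ⟨stellarVertex g γ y ε, fun p q m l h => (key p q m).1 ⟨l, h.symm⟩,
    fun p q m h => (key p q m).2 h⟩

end stellar

/-! ### Termination of repeated stellar subdivision -/

theorem sum_stellarGen_lt {ι : Type} [Fintype ι] {g : ι → Matrix (Fin n) (Fin n) ℤ}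
    {γ : Fin n → ℤ} [Fintype (StellarIndex g γ)] (m : Matrix (Fin n) (Fin n) ℤ → ℕ) {i : ι}
    (hi : 0 ≤ coords (g i) (latticeHom n γ))
    (h : ∀ j k, 0 ≤ coords (g j) (latticeHom n γ) → 0 < coords (g j) (latticeHom n γ) k →
      m ((g j).updateRow k γ) < m (g j)) :
    ∑ p, (n + 1) ^ m (stellarGen g γ p) < ∑ j, (n + 1) ^ m (g j) := by
  classical
  rw [← Finset.sum_fiberwise Finset.univ fun p : StellarIndex g γ => p.1.1]
  -- A subdivided cone gives at most `n` cones with smaller `m`. The base `n + 1` makes the total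
  -- weight drop, because `n` times the next lower power is less than the original one.
  have hlt : ∀ j, 0 ≤ coords (g j) (latticeHom n γ) →
      ∑ p : StellarIndex g γ with p.1.1 = j, (n + 1) ^ m (stellarGen g γ p) <
        (n + 1) ^ m (g j) := fun j hj => by
    have hcard : (Finset.univ.filter fun p : StellarIndex g γ => p.1.1 = j).card ≤ n := by
      calc _ ≤ ((Finset.univ : Finset (Fin n)).image some).card := by
            refine Finset.card_le_card_of_injOn (fun p => p.1.2) (fun p hp => ?_)
              fun p hp q hq hpq => ?_
            · simp only [Finset.coe_filter, Finset.mem_univ, true_and, Set.mem_ofPred_eq] at hp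
              rcases p.2 with ⟨_, h2⟩ | ⟨k, h1, _⟩
              · rw [hp] at h2
                exact absurd hj h2
              · simp [h1]
            · simp only [Finset.coe_filter, Finset.mem_univ, true_and, Set.mem_ofPred_eq] at hp hq
              exact Subtype.ext (Prod.ext (hp.trans hq.symm) hpq)
        _ = n := by
          rw [Finset.card_image_of_injective _ (Option.some_injective _), Finset.card_univ,
            Fintype.card_fin]
    have hle : ∀ p ∈ Finset.univ.filter fun p : StellarIndex g γ => p.1.1 = j,
        (n + 1) * (n + 1) ^ m (stellarGen g γ p) ≤ (n + 1) ^ m (g j) := fun p hp => by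
      rw [← pow_succ']
      refine Nat.pow_le_pow_right n.succ_pos ?_
      simp only [Finset.mem_filter, Finset.mem_univ, true_and] at hp
      subst hp
      induction p using StellarIndex.cases with
      | old i h => exact absurd hj h
      | new i k hi hk => exact h i k hi hk
    have h1 := Finset.sum_le_card_nsmul _ _ _ hle
    rw [← Finset.mul_sum, smul_eq_mul] at h1
    have h2 := h1.trans (Nat.mul_le_mul_right _ hcard)
    have hpos : 0 < (n + 1) ^ m (g j) := Nat.pow_pos n.succ_pos
    by_contra hcon
    push Not at hcon
    have h3 := Nat.mul_le_mul_left (n + 1) hcon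
    nlinarith
  refine Finset.sum_lt_sum (fun j _ => ?_) ⟨i, Finset.mem_univ i, hlt i hi⟩
  by_cases hj : 0 ≤ coords (g j) (latticeHom n γ)
  · exact (hlt j hj).le
  · let p₀ : StellarIndex g γ := ⟨(j, none), Or.inl ⟨rfl, hj⟩⟩
    have : (Finset.univ.filter fun p : StellarIndex g γ => p.1.1 = j) = {p₀} := by
      ext p
      rw [Finset.mem_filter, Finset.mem_singleton]
      refine ⟨fun hp => ?_, fun hp => hp ▸ ⟨Finset.mem_univ _, rfl⟩⟩
      obtain ⟨-, hp⟩ := hp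
      rcases p.2 with ⟨h1, -⟩ | ⟨k, -, h2, -⟩
      · exact Subtype.ext (Prod.ext hp h1)
      · rw [hp] at h2
        exact absurd h2 hj
    rw [this, Finset.sum_singleton]
    exact le_rfl

/-- Stellar subdivisions remove all bad cones if each of them decreases a natural number attached
to the cones it subdivides. -/
theorem exists_finer_forall_not (bad : Matrix (Fin n) (Fin n) ℤ → Prop)
    (m : Matrix (Fin n) (Fin n) ℤ → ℕ)
    (step : ∀ {ι : Type} [Finite ι] (g : ι → Matrix (Fin n) (Fin n) ℤ), IsConvexFan g →
      ∀ i, bad (g i) → ∃ γ, γ ≠ 0 ∧ 0 ≤ coords (g i) (latticeHom n γ) ∧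
        ∀ j k, 0 ≤ coords (g j) (latticeHom n γ) → 0 < coords (g j) (latticeHom n γ) k →
          m ((g j).updateRow k γ) < m (g j))
    {ι : Type} [Finite ι] {g : ι → Matrix (Fin n) (Fin n) ℤ} (hg : IsConvexFan g) :
    ∃ (ι' : Type) (_ : Finite ι') (g' : ι' → Matrix (Fin n) (Fin n) ℤ),
      IsConvexFan g' ∧ Finer g' g ∧ ∀ i, ¬ bad (g' i) := by
  cases nonempty_fintype ι
  induction hN : ∑ j, (n + 1) ^ m (g j) using Nat.strong_induction_on generalizing ι with
  | _ N ih =>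
    by_cases hbad : ∃ i, bad (g i)
    · obtain ⟨i, hi⟩ := hbad
      obtain ⟨γ, hγ, hiγ, hdec⟩ := step g hg i hi
      cases nonempty_fintype (StellarIndex g γ)
      obtain ⟨ι', hfin, g', h1, h2, h3⟩ := ih _ (hN ▸ sum_stellarGen_lt m hiγ hdec)
        (isConvexFan_stellarGen hg hγ) _ rfl
      exact ⟨ι', hfin, g', h1, h2.trans (stellarGen_det_ne_zero hg.det_ne_zero)
        (stellarGen_finer hg.det_ne_zero), h3⟩
    · push Not at hbad
      exact ⟨ι, inferInstance, g, hg, Finer.refl hg.det_ne_zero, hbad⟩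

/-! ### Reduction to multiplicity one -/

theorem natAbs_det_updateRow_lt {A : Matrix (Fin n) (Fin n) ℤ} (hA : A.det ≠ 0) {k : Fin n}
    {γ : Fin n → ℤ} (h0 : 0 ≤ coords A (latticeHom n γ) k) (h1 : coords A (latticeHom n γ) k < 1) :
    (A.updateRow k γ).det.natAbs < A.det.natAbs := by
  zify
  have h : (|((A.updateRow k γ).det : ℝ)|) < |(A.det : ℝ)| := by
    rw [det_updateRow_eq hA, abs_mul, abs_of_nonneg h0]
    exact mul_lt_of_lt_one_left (abs_pos.2 (Int.cast_ne_zero.2 hA)) h1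
  exact_mod_cast h

/-- A lattice point in the half-open parallelepiped spanned by the rows of `A`. -/
theorem exists_coords_mem_Ico {A : Matrix (Fin n) (Fin n) ℤ} (hA : A.det ≠ 0)
    (hA1 : A.det.natAbs ≠ 1) : ∃ γ : Fin n → ℤ, γ ≠ 0 ∧
      ∀ k, 0 ≤ coords A (latticeHom n γ) k ∧ coords A (latticeHom n γ) k < 1 := by
  -- The rows do not generate the lattice, so some lattice vector has a coordinate that is not
  -- integral; its fractional part is the required point.
  have hns : ¬ Function.Surjective fun v : Fin n → ℤ => v ᵥ* A := by
    rw [vecMul_surjective_iff_isUnit, isUnit_iff_isUnit_det, Int.isUnit_iff_natAbs_eq]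
    exact hA1
  simp only [Function.Surjective, not_forall, not_exists] at hns
  obtain ⟨z, hz⟩ := hns
  let f : Fin n → ℤ := fun k => ⌊coords A (latticeHom n z) k⌋
  refine ⟨z - f ᵥ* A, fun h => hz f (sub_eq_zero.1 h).symm, fun k => ?_⟩
  rw [map_sub, map_sub, coords_latticeHom_vecMul hA]
  exact ⟨Int.fract_nonneg _, Int.fract_lt_one _⟩

/-- Any other cone containing `γ` sees the same positive coordinates as the `i`-th one, all below
one. By Cramer's rule the determinant then shrinks in every cone that is subdivided, not only in the
bad one. -/
theorem exists_decreasing_of_natAbs_det_ne_one {ι : Type} [Finite ι]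
    (g : ι → Matrix (Fin n) (Fin n) ℤ) (hg : IsConvexFan g) (i : ι) (hi : (g i).det.natAbs ≠ 1) :
    ∃ γ, γ ≠ 0 ∧ 0 ≤ coords (g i) (latticeHom n γ) ∧
      ∀ j k, 0 ≤ coords (g j) (latticeHom n γ) → 0 < coords (g j) (latticeHom n γ) k →
        ((g j).updateRow k γ).det.natAbs < (g j).det.natAbs := by
  obtain ⟨γ, hγ, hlt⟩ := exists_coords_mem_Ico (hg.det_ne_zero i) hi
  have hiγ : 0 ≤ coords (g i) (latticeHom n γ) := fun k => (hlt k).1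
  refine ⟨γ, hγ, hiγ, fun j k hj hk => ?_⟩
  obtain ⟨l, hl, hl'⟩ := hg.exists_row hj hiγ hk
  exact natAbs_det_updateRow_lt (hg.det_ne_zero j) hk.le (hl' ▸ (hlt l).2)

/-- Resolution of singularities: a simplicial fan has a unimodular refinement. -/
theorem exists_finer_natAbs_det_eq_one {ι : Type} [Finite ι]
    {g : ι → Matrix (Fin n) (Fin n) ℤ} (hg : IsConvexFan g) :
    ∃ (ι' : Type) (_ : Finite ι') (g' : ι' → Matrix (Fin n) (Fin n) ℤ),
      IsConvexFan g' ∧ Finer g' g ∧ ∀ i, (g' i).det.natAbs = 1 := by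
  obtain ⟨ι', hfin, g', h1, h2, h3⟩ := exists_finer_forall_not (fun A => A.det.natAbs ≠ 1)
    (fun A => A.det.natAbs) exists_decreasing_of_natAbs_det_ne_one hg
  exact ⟨ι', hfin, g', h1, h2, fun i => not_not.1 (h3 i)⟩

/-! ### Subdivision along hyperplanes -/

/-- The rows of `A` lie on one side of the hyperplane with normal vector `u`. -/
def OneSided (u : Fin n → ℤ) (A : Matrix (Fin n) (Fin n) ℤ) : Prop :=
  (∀ k, 0 ≤ u ⬝ᵥ A k) ∨ (∀ k, u ⬝ᵥ A k ≤ 0)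

theorem latticeHom_dotProduct_eq_sum {A : Matrix (Fin n) (Fin n) ℤ} (hA : A.det ≠ 0)
    (u : Fin n → ℤ) (x : Fin n → ℝ) :
    latticeHom n u ⬝ᵥ x = ∑ k, coords A x k * ((u ⬝ᵥ A k : ℤ) : ℝ) := by
  rw [dotProduct_eq_sum_coords hA]
  simp only [latticeHom_dotProduct]

theorem OneSided.of_coords_nonneg {u : Fin n → ℤ} {A B : Matrix (Fin n) (Fin n) ℤ}
    (hA : A.det ≠ 0) (h : OneSided u A) (hB : ∀ k, 0 ≤ coords A (latticeHom n (B k))) :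
    OneSided u B := by
  have key : ∀ k, ((u ⬝ᵥ B k : ℤ) : ℝ) =
      ∑ l, coords A (latticeHom n (B k)) l * ((u ⬝ᵥ A l : ℤ) : ℝ) := fun k => by
    rw [← latticeHom_dotProduct, latticeHom_dotProduct_eq_sum hA]
  rcases h with h | h
  · refine Or.inl fun k => ?_
    rw [← Int.cast_nonneg_iff (R := ℝ), key]
    exact Finset.sum_nonneg fun l _ => mul_nonneg (hB k l) (by exact_mod_cast h l)
  · refine Or.inr fun k => ?_
    rw [← Int.cast_nonpos (R := ℝ), key]
    exact Finset.sum_nonpos fun l _ =>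
      mul_nonpos_of_nonneg_of_nonpos (hB k l) (by exact_mod_cast h l)

/-- Two generators strictly on opposite sides span a plane cone that meets the hyperplane in a ray,
and `γ` is taken on that ray. In every cone containing `γ`, each generator that can be replaced is
one of these two, so the number of generators off the hyperplane drops. -/
theorem exists_decreasing_of_not_oneSided (u : Fin n → ℤ) {ι : Type} [Finite ι]
    (g : ι → Matrix (Fin n) (Fin n) ℤ) (hg : IsConvexFan g) (i : ι) (hi : ¬ OneSided u (g i)) :
    ∃ γ, γ ≠ 0 ∧ 0 ≤ coords (g i) (latticeHom n γ) ∧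
      ∀ j k, 0 ≤ coords (g j) (latticeHom n γ) → 0 < coords (g j) (latticeHom n γ) k →
        (Finset.univ.filter fun l => u ⬝ᵥ (g j).updateRow k γ l ≠ 0).card <
          (Finset.univ.filter fun l => u ⬝ᵥ g j l ≠ 0).card := by
  have hdet := hg.det_ne_zero
  simp only [OneSided, not_or, not_forall, not_le] at hi
  obtain ⟨⟨a, ha⟩, b, hb⟩ := hi
  have hab : a ≠ b := fun h => by
    rw [h] at ha
    exact lt_asymm ha hb
  let c : Fin n → ℤ := Pi.single a (u ⬝ᵥ g i b) + Pi.single b (-(u ⬝ᵥ g i a))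
  let γ : Fin n → ℤ := c ᵥ* g i
  have hγu : u ⬝ᵥ γ = 0 := by
    simp only [γ, c, add_vecMul, single_vecMul, dotProduct_add, dotProduct_smul, smul_eq_mul]
    simp [row]
    ring
  have hcoords : coords (g i) (latticeHom n γ) = latticeHom n c :=
    coords_latticeHom_vecMul (hdet i) c
  have hc0 : ∀ k, k ≠ a → k ≠ b → c k = 0 := fun k hka hkb => by
    simp [c, hka, hkb]
  have hca : c a = u ⬝ᵥ g i b := by simp [c, hab]
  have hcb : c b = -(u ⬝ᵥ g i a) := by simp [c, hab.symm]
  have hiγ : 0 ≤ coords (g i) (latticeHom n γ) := fun k => by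
    rw [hcoords]
    change (0 : ℝ) ≤ (c k : ℝ)
    rw [Int.cast_nonneg_iff]
    by_cases hka : k = a
    · rw [hka, hca]; exact hb.le
    by_cases hkb : k = b
    · rw [hkb, hcb]; linarith
    exact (hc0 k hka hkb).ge
  refine ⟨γ, fun h => ?_, hiγ, fun j k hj hk => ?_⟩
  · have h0 : c a = 0 := by
      have := congrFun hcoords a
      rw [h, map_zero, map_zero] at this
      have : (0 : ℝ) = (c a : ℝ) := this
      exact_mod_cast this.symm
    rw [hca] at h0
    exact hb.ne' h0
  · obtain ⟨l, hl, hl'⟩ := hg.exists_row hj hiγ hk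
    rw [← hl', hcoords] at hk
    have hk' : c l ≠ 0 := fun h => by
      rw [latticeHom_apply, h] at hk
      simp at hk
    have hul : u ⬝ᵥ g j k ≠ 0 := by
      rw [← hl]
      by_cases hla : l = a
      · rw [hla]; exact ha.ne
      by_cases hlb : l = b
      · rw [hlb]; exact hb.ne'
      exact absurd (hc0 l hla hlb) hk'
    refine Finset.card_lt_card (Finset.ssubset_iff_of_subset (fun m hm => ?_) |>.2
      ⟨k, by simpa using hul, by simp [hγu]⟩)
    simp only [Finset.mem_filter, Finset.mem_univ, true_and] at hm ⊢
    by_cases hmk : m = k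
    · rwa [hmk]
    · rwa [updateRow_ne hmk] at hm

theorem exists_finer_oneSided (u : Fin n → ℤ) {ι : Type} [Finite ι]
    {g : ι → Matrix (Fin n) (Fin n) ℤ} (hg : IsConvexFan g) :
    ∃ (ι' : Type) (_ : Finite ι') (g' : ι' → Matrix (Fin n) (Fin n) ℤ),
      IsConvexFan g' ∧ Finer g' g ∧ ∀ i, OneSided u (g' i) := by
  obtain ⟨ι', hfin, g', h1, h2, h3⟩ := exists_finer_forall_not (fun A => ¬ OneSided u A)
    (fun A => (Finset.univ.filter fun k => u ⬝ᵥ A k ≠ 0).card) (exists_decreasing_of_not_oneSided u) hg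
  exact ⟨ι', hfin, g', h1, h2, fun i => not_not.1 (h3 i)⟩

theorem exists_finer_forall_oneSided {ι : Type} [Finite ι]
    {g : ι → Matrix (Fin n) (Fin n) ℤ} (hg : IsConvexFan g) (s : Finset (Fin n → ℤ)) :
    ∃ (ι' : Type) (_ : Finite ι') (g' : ι' → Matrix (Fin n) (Fin n) ℤ),
      IsConvexFan g' ∧ Finer g' g ∧ ∀ u ∈ s, ∀ i, OneSided u (g' i) := by
  classical
  induction s using Finset.induction_on with
  | empty => exact ⟨ι, inferInstance, g, hg, Finer.refl hg.det_ne_zero, by simp⟩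
  | insert u s _ ih =>
    obtain ⟨ι', hfin, g', h1, h2, h3⟩ := ih
    obtain ⟨ι'', hfin', g'', h1', h2', h3'⟩ := exists_finer_oneSided u h1
    refine ⟨ι'', hfin', g'', h1', h2'.trans h1.det_ne_zero h2, fun v hv i => ?_⟩
    rcases Finset.mem_insert.1 hv with rfl | hv
    · exact h3' i
    · obtain ⟨j, hj⟩ := h2' i
      exact (h3 v hv j).of_coords_nonneg (h1.det_ne_zero j) hj

/-! ### The fan of orthants -/

/-- The generators of the orthants. -/
def orthantGen (s : Fin n → ℤˣ) : Matrix (Fin n) (Fin n) ℤ := diagonal fun k => (s k : ℤ)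

theorem orthantGen_row (s : Fin n → ℤˣ) (k : Fin n) :
    orthantGen s k = Pi.single k (s k : ℤ) := by
  funext l
  simp only [orthantGen, diagonal_apply, Pi.single_apply, eq_comm]

theorem orthantGen_det_ne_zero (s : Fin n → ℤˣ) : (orthantGen s).det ≠ 0 := by
  rw [orthantGen, det_diagonal]
  exact Finset.prod_ne_zero_iff.2 fun k _ => (s k).ne_zero

/-- This is the normal fan of the cube, whose vertices are the sign vectors. -/
theorem isConvexFan_orthantGen : IsConvexFan (orthantGen (n := n)) := by
  have hdot : ∀ (s t : Fin n → ℤˣ) k, (fun m => ((t m : ℤ) : ℝ)) ⬝ᵥ latticeHom n (orthantGen s k) =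
      ((t k : ℤ) : ℝ) * ((s k : ℤ) : ℝ) := fun s t k => by
    have : latticeHom n (orthantGen s k) = Pi.single k (((s k : ℤ) : ℝ)) := by
      rw [orthantGen_row]
      funext l
      simp only [latticeHom_apply, Pi.single_apply]
      split_ifs <;> simp
    rw [this, dotProduct_single]
  refine ⟨orthantGen_det_ne_zero, fun x => ?_, fun s m => ((s m : ℤ) : ℝ), ?_, ?_⟩
  · classical
    let s : Fin n → ℤˣ := fun k => if 0 ≤ x k then 1 else -1
    refine ⟨s, ?_⟩
    have : coords (orthantGen s) x = fun k => |x k| := by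
      refine eq_coords (orthantGen_det_ne_zero s) ?_
      funext l
      simp only [Finset.sum_apply, Pi.smul_apply, latticeHom_apply, orthantGen_row, smul_eq_mul,
        Pi.single_apply]
      simp only [apply_ite (Int.cast : ℤ → ℝ), Int.cast_zero, mul_ite, mul_zero,
        Finset.sum_ite_eq, Finset.mem_univ, if_true, s]
      split_ifs with h
      · simp [abs_of_nonneg h]
      · simp [abs_of_neg (not_le.1 h)]
    rw [this]
    exact fun k => abs_nonneg _
  · intro s t k l h
    rw [hdot, hdot]
    rw [orthantGen_row, orthantGen_row] at h
    have hkl : k = l := by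
      by_contra hkl
      have := congrFun h k
      simp [hkl] at this
    subst hkl
    rw [Pi.single_inj] at h
    rw [h]
  · intro s t k h
    rw [hdot, hdot]
    have hne : s k ≠ t k := fun hst => h k (by rw [orthantGen_row, orthantGen_row, hst])
    rcases Int.units_eq_one_or (s k) with h1 | h1 <;> rcases Int.units_eq_one_or (t k) with h2 | h2 <;>
      simp_all

/-! ### Refining a rational complete fan -/

/-- Carathéodory's theorem for cones: the generators in a positive combination can be chosen
linearly independent. -/
theorem exists_linearIndepOn_sum_eq {ι M : Type*} [AddCommGroup M] [Module ℝ M] (f : ι → M)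
    (s : Finset ι) (c : ι → ℝ) (hc : ∀ i ∈ s, 0 < c i) :
    ∃ t ⊆ s, ∃ d : ι → ℝ, (∀ i ∈ t, 0 < d i) ∧ LinearIndepOn ℝ f (t : Set ι) ∧
      ∑ i ∈ t, d i • f i = ∑ i ∈ s, c i • f i := by
  classical
  induction s using Finset.strongInduction generalizing c with
  | H s ih =>
    by_cases hli : LinearIndepOn ℝ f (s : Set ι)
    · exact ⟨s, subset_rfl, c, hc, hli, rfl⟩
    obtain ⟨e, he, i₀, hi₀s, hi₀⟩ : ∃ e : ι → ℝ, ∑ i ∈ s, e i • f i = 0 ∧ ∃ i ∈ s, 0 < e i := by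
      rw [linearIndepOn_finset_iff] at hli
      push Not at hli
      obtain ⟨e, he, i, hi, hne⟩ := hli
      rcases lt_or_gt_of_ne hne with h | h
      · exact ⟨-e, by simp [he], i, hi, by simpa using h⟩
      · exact ⟨e, he, i, hi, h⟩
    obtain ⟨k, hk, hmin⟩ := Finset.exists_min_image (s.filter fun i => 0 < e i)
      (fun i => c i / e i) ⟨i₀, by simp [hi₀s, hi₀]⟩
    simp only [Finset.mem_filter] at hk hmin
    set t := c k / e k with ht
    let c' : ι → ℝ := fun i => c i - t * e i
    have hc' : ∀ i ∈ s, 0 ≤ c' i := fun i hi => by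
      simp only [c', sub_nonneg]
      rcases le_or_gt (e i) 0 with h | h
      · exact (mul_nonpos_of_nonneg_of_nonpos (div_pos (hc k hk.1) hk.2).le h).trans (hc i hi).le
      · have := hmin i ⟨hi, h⟩
        rwa [le_div_iff₀ h] at this
    have hck : c' k = 0 := by
      simp only [c', ht, div_mul_cancel₀ _ hk.2.ne', sub_self]
    have hsum : ∑ i ∈ s, c' i • f i = ∑ i ∈ s, c i • f i := by
      simp only [c', sub_smul, Finset.sum_sub_distrib, mul_smul, ← Finset.smul_sum, he, smul_zero,
        sub_zero]
    have hss : (s.filter fun i => 0 < c' i) ⊂ s :=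
      Finset.filter_ssubset.2 ⟨k, hk.1, by simp [hck]⟩
    obtain ⟨u, hu, d, hd, hli', hsum'⟩ := ih _ hss c' fun i hi => (Finset.mem_filter.1 hi).2
    refine ⟨u, hu.trans hss.subset, d, hd, hli', hsum'.trans (Eq.trans ?_ hsum)⟩
    refine Finset.sum_subset hss.subset fun i hi hi' => ?_
    have : c' i = 0 := le_antisymm (not_lt.1 fun h => hi' (Finset.mem_filter.2 ⟨hi, h⟩)) (hc' i hi)
    rw [this, zero_smul]

theorem span_range_latticeHom_single :
    Submodule.span ℝ (latticeHom n '' Set.range fun k : Fin n => Pi.single k (1 : ℤ)) = ⊤ := by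
  have : latticeHom n '' (Set.range fun k : Fin n => Pi.single k (1 : ℤ)) =
      Set.range (Pi.basisFun ℝ (Fin n)) := by
    rw [← Set.range_comp]
    congr 1
    funext k l
    simp only [Function.comp, latticeHom_apply, Pi.basisFun_apply, Pi.single_apply]
    split_ifs <;> simp
  rw [this, Module.Basis.span_eq]

/-- A point of the cone generated by `s` lies in a full-dimensional simplicial cone, in which only
generators from `s` are used for it. -/
theorem exists_matrix_of_mem_hull {s : Finset (Fin n → ℤ)} {x : Fin n → ℝ}
    (hx : x ∈ PointedCone.hull ℝ (latticeHom n '' (s : Set (Fin n → ℤ)))) :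
    ∃ B : Matrix (Fin n) (Fin n) ℤ, B.det ≠ 0 ∧
      (∀ k, B k ∈ s ∨ B k ∈ Set.range fun k : Fin n => Pi.single k (1 : ℤ)) ∧
      0 ≤ coords B x ∧ ∀ k, coords B x k ≠ 0 → B k ∈ s := by
  classical
  obtain ⟨c, hcs, hc⟩ := (Finsupp.mem_span_image_iff_linearCombination _).1 hx
  rw [Finsupp.mem_supported] at hcs
  obtain ⟨t, hts, d, hd, hli, hsum⟩ := exists_linearIndepOn_sum_eq (latticeHom n)
    c.support (fun i => (c i : ℝ)) fun i hi =>
      lt_of_le_of_ne (c i).2 fun h => Finsupp.mem_support_iff.1 hi (Subtype.ext h.symm)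
  replace hsum : ∑ i ∈ t, d i • latticeHom n i = x := by
    rw [hsum, ← hc, Finsupp.linearCombination_apply, Finsupp.sum]
    rfl
  obtain ⟨b, hbt, htb, hspan, hbli⟩ := exists_linearIndepOn_extension (K := ℝ)
    (v := latticeHom n) (s := (t : Set (Fin n → ℤ)))
    (t := t ∪ Set.range fun k : Fin n => Pi.single k (1 : ℤ)) hli Set.subset_union_left
  have htop : ⊤ ≤ Submodule.span ℝ (Set.range fun v : b => latticeHom n v) := by
    rw [← span_range_latticeHom_single, Submodule.span_le]
    refine (Set.image_mono Set.subset_union_right).trans (hspan.trans ?_)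
    rw [← Set.image_eq_range]
  let bas := Module.Basis.mk hbli htop
  have : Fintype b := FiniteDimensional.fintypeBasisIndex bas
  have hcard : Fintype.card b = n := by
    rw [← Module.finrank_eq_card_basis bas, Module.finrank_fin_fun]
  let e : Fin n ≃ b := (Fintype.equivFinOfCardEq hcard).symm
  let B : Matrix (Fin n) (Fin n) ℤ := fun k => (e k : Fin n → ℤ)
  have hB : B.det ≠ 0 := by
    have h1 : LinearIndependent ℝ (B.map (Int.cast : ℤ → ℝ)).row :=
      (hbli.comp e e.injective : LinearIndependent ℝ fun k => latticeHom n (e k))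
    rw [linearIndependent_rows_iff_isUnit, isUnit_iff_isUnit_det] at h1
    have h2 : (B.map (Int.cast : ℤ → ℝ)).det = (B.det : ℝ) :=
      ((Int.castRingHom ℝ).map_det B).symm
    rw [h2] at h1
    exact_mod_cast h1.ne_zero
  have hcoords : coords B x = fun k => if B k ∈ t then d (B k) else 0 := by
    refine eq_coords hB ?_
    rw [← hsum, Equiv.sum_comp e fun v : b =>
      (if (v : Fin n → ℤ) ∈ t then d v else 0) • latticeHom n v]
    symm
    rw [← Finset.sum_subtype_of_mem (p := fun v => v ∈ b) (fun v => d v • latticeHom n v)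
      fun v hv => htb hv]
    refine Finset.sum_subset_zero_on_sdiff (Finset.subset_univ _) (fun v hv => ?_) fun v hv => ?_
    · rw [if_neg fun h => (Finset.mem_sdiff.1 hv).2 (by simpa using h), zero_smul]
    · rw [if_pos (by simpa using hv)]
  refine ⟨B, hB, fun k => ?_, fun k => ?_, fun k hk => ?_⟩
  · rcases hbt (e k).2 with h | h
    · exact Or.inl (hcs (hts h))
    · exact Or.inr h
  · rw [hcoords]
    change 0 ≤ if B k ∈ t then d (B k) else 0
    split_ifs with h
    exacts [(hd _ h).le, le_rfl]
  · rw [hcoords] at hk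
    have hk' : (if B k ∈ t then d (B k) else 0) ≠ 0 := hk
    split_ifs at hk' with h
    · exact hcs (hts h)
    · exact absurd rfl hk'

theorem mem_hull_of_coords {B : Matrix (Fin n) (Fin n) ℤ} (hB : B.det ≠ 0)
    {s : Set (Fin n → ℝ)} {x : Fin n → ℝ} (hx : 0 ≤ coords B x)
    (h : ∀ k, coords B x k ≠ 0 → latticeHom n (B k) ∈ s) : x ∈ PointedCone.hull ℝ s := by
  rw [← sum_coords hB x]
  refine Submodule.sum_mem _ fun k _ => ?_
  by_cases hk : coords B x k = 0
  · rw [hk, zero_smul]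
    exact zero_mem _
  · exact PointedCone.smul_mem _ (hx k) (PointedCone.subset_hull (h k hk))

/-- The columns of the adjugate are thus integral normal vectors of the facets of the cone of `B`.
-/
theorem adjugate_col_dotProduct {B : Matrix (Fin n) (Fin n) ℤ} (hB : B.det ≠ 0) (k : Fin n)
    (x : Fin n → ℝ) :
    latticeHom n (fun j => B.adjugate j k) ⬝ᵥ x = coords B x k * B.det := by
  rw [latticeHom_dotProduct_eq_sum hB, Finset.sum_eq_single k]
  · congr 2
    rw [dotProduct_comm]
    have := congrFun (congrFun (mul_adjugate B) k) k
    rw [mul_apply] at this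
    simpa [dotProduct] using this
  · intro l _ hl
    rw [dotProduct_comm]
    have := congrFun (congrFun (mul_adjugate B) l) k
    rw [mul_apply] at this
    rw [Matrix.smul_apply, one_apply_ne hl, smul_zero] at this
    rw [dotProduct, this, Int.cast_zero, mul_zero]
  · simp

/-- If the rows of `A` lie on one side of each facet hyperplane of the cone of `B` and their sum is
in that cone, then all rows of `A` are in that cone, and their sum is in its interior. -/
theorem coords_of_oneSided {A B : Matrix (Fin n) (Fin n) ℤ} (hA : A.det ≠ 0) (hB : B.det ≠ 0)
    (h : ∀ k, OneSided (fun j => B.adjugate j k) A)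
    (hx : 0 ≤ coords B (∑ k, latticeHom n (A k))) :
    (∀ k, 0 ≤ coords B (latticeHom n (A k))) ∧ ∀ k, coords B (∑ k, latticeHom n (A k)) k ≠ 0 := by
  have hdet : (B.det : ℝ) ≠ 0 := Int.cast_ne_zero.2 hB
  have hsign : ∀ k, (∀ l, 0 ≤ coords B (latticeHom n (A l)) k) ∨
      (∀ l, coords B (latticeHom n (A l)) k ≤ 0) := fun k => by
    have hcast : ∀ l, (((fun j => B.adjugate j k) ⬝ᵥ A l : ℤ) : ℝ) =
        coords B (latticeHom n (A l)) k * B.det := fun l => by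
      rw [← latticeHom_dotProduct, adjugate_col_dotProduct hB]
    rcases h k with h' | h' <;> rcases lt_or_gt_of_ne hdet with hd | hd
    · refine Or.inr fun l => nonpos_of_mul_nonneg_left ?_ hd
      rw [← hcast]; exact_mod_cast h' l
    · refine Or.inl fun l => nonneg_of_mul_nonneg_left ?_ hd
      rw [← hcast]; exact_mod_cast h' l
    · refine Or.inl fun l => ?_
      have : coords B (latticeHom n (A l)) k * B.det ≤ 0 := by rw [← hcast]; exact_mod_cast h' l
      by_contra hcon
      exact absurd this (not_le.2 (mul_pos_of_neg_of_neg (not_le.1 hcon) hd))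
    · refine Or.inr fun l => ?_
      have : coords B (latticeHom n (A l)) k * B.det ≤ 0 := by rw [← hcast]; exact_mod_cast h' l
      exact nonpos_of_mul_nonpos_left this hd
  have hsum : ∀ k, coords B (∑ l, latticeHom n (A l)) k = ∑ l, coords B (latticeHom n (A l)) k :=
    fun k => by rw [map_sum, Finset.sum_apply]
  -- a coordinate of the sum vanishes only if it vanishes on all rows
  have hne : ∀ k, coords B (∑ l, latticeHom n (A l)) k ≠ 0 := fun k h0 => by
    have hall : ∀ l, coords B (latticeHom n (A l)) k = 0 := by
      rw [hsum] at h0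
      rcases hsign k with hs | hs
      · exact fun l => (Finset.sum_eq_zero_iff_of_nonneg fun l _ => hs l).1 h0 l (Finset.mem_univ l)
      · exact fun l => (Finset.sum_eq_zero_iff_of_nonpos fun l _ => hs l).1 h0 l (Finset.mem_univ l)
    have h1 : coords B (latticeHom n (B k)) k = 0 := by
      rw [← sum_coords hA (latticeHom n (B k)), map_sum, Finset.sum_apply]
      exact Finset.sum_eq_zero fun l _ => by rw [map_smul, Pi.smul_apply, hall, smul_zero]
    rw [coords_row hB, Pi.single_eq_same] at h1
    exact one_ne_zero h1
  refine ⟨fun l k => ?_, hne⟩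
  rcases hsign k with hs | hs
  · exact hs l
  · refine absurd (le_antisymm ?_ (hx k)) (hne k)
    rw [hsum]
    exact Finset.sum_nonpos fun l _ => hs l

/-- Every rational complete fan has a simplicial refinement with a strictly convex support
function. -/
theorem exists_isConvexFan_refining (S : PolyhedralFan n) (hrat : S.IsRational)
    (hcomplete : S.IsComplete) :
    ∃ (ι : Type) (_ : Finite ι) (g : ι → Matrix (Fin n) (Fin n) ℤ),
      IsConvexFan g ∧ ∀ i, ∃ C ∈ S.cones, ∀ k, latticeHom n (g i k) ∈ C := by
  classical
  choose s hs using hrat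
  let E : Set (Fin n → ℤ) := Set.range fun k : Fin n => Pi.single k (1 : ℤ)
  let G : Set (Fin n → ℤ) := (⋃ C : S.cones, (s C.1 C.2 : Set (Fin n → ℤ))) ∪ E
  have : Finite S.cones := S.finite
  have hG : G.Finite :=
    (Set.finite_iUnion fun C : S.cones => (s C.1 C.2).finite_toSet).union (Set.finite_range _)
  -- All facet normals of simplicial cones spanned by the given generators and unit vectors. The
  -- unit vectors serve to complete independent generators of a lower-dimensional cone to a basis.
  let U : Set (Fin n → ℤ) := ⋃ k : Fin n,
    (fun (B : Matrix (Fin n) (Fin n) ℤ) j => B.adjugate j k) '' {B | ∀ k, B k ∈ G}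
  have hU : U.Finite := Set.finite_iUnion fun k => (Set.Finite.pi' fun _ => hG).image _
  obtain ⟨ι, hfin, g, hg, -, hside⟩ := exists_finer_forall_oneSided
    (isConvexFan_orthantGen (n := n)) hU.toFinset
  refine ⟨ι, hfin, g, hg, fun i => ?_⟩
  -- The cone of `S` is selected by an interior point of the `i`-th cone.
  obtain ⟨C, hC, hx⟩ := hcomplete (∑ k, latticeHom n (g i k))
  refine ⟨C, hC, ?_⟩
  rw [hs C hC] at hx
  obtain ⟨B, hB, hBG, hB0, hBs⟩ := exists_matrix_of_mem_hull hx
  have hBG' : ∀ k, B k ∈ G := fun k => (hBG k).imp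
    (fun h => Set.mem_iUnion.2 ⟨⟨C, hC⟩, h⟩) id
  obtain ⟨h1, h2⟩ := coords_of_oneSided (hg.det_ne_zero i) hB (fun k => hside _
    (hU.mem_toFinset.2 (Set.mem_iUnion.2 ⟨k, B, hBG', rfl⟩)) i) hB0
  intro k
  rw [hs C hC]
  -- No coordinate of the interior point vanishes, so every row of `B` is one of the generators of
  -- `C`, not a unit vector added to complete the basis.
  exact mem_hull_of_coords hB (h1 k) fun l _ => Set.mem_image_of_mem _ (hBs l (h2 l))

/-- Repeated maximal cones can be removed. -/
theorem exists_finer_injective {ι : Type} [Finite ι] {g : ι → Matrix (Fin n) (Fin n) ℤ}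
    (hg : IsConvexFan g) :
    ∃ (ι' : Type) (_ : Finite ι') (f : ι' → ι), IsConvexFan (fun i => g (f i)) ∧
      ∀ i j, (∀ k, ∃ l, g (f j) l = g (f i) k) → i = j := by
  classical
  -- One index is kept for each set of generators.
  let r : ι → Set (Fin n → ℤ) := fun i => Set.range (g i)
  have hr : ∀ t : Set.range r, ∃ i, r i = t.1 := fun t => t.2
  choose f hf using hr
  obtain ⟨y, h1, h2⟩ := hg.convex
  refine ⟨Set.range r, inferInstance, f, ⟨fun i => hg.det_ne_zero _, fun x => ?_,
    fun i => y (f i), fun i j => h1 (f i) (f j), fun i j => h2 (f i) (f j)⟩, fun i j h => ?_⟩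
  · obtain ⟨i, hi⟩ := hg.cover x
    refine ⟨⟨r i, i, rfl⟩, coords_nonneg_of_support (hg.det_ne_zero i) (hg.det_ne_zero _) hi
      fun k _ => ?_⟩
    have : g i k ∈ r (f ⟨r i, i, rfl⟩) := by
      rw [hf]
      exact ⟨k, rfl⟩
    exact this
  · have hsub : r (f i) ⊆ r (f j) := by
      rintro _ ⟨k, rfl⟩
      exact h k
    have hrange : ∀ v : Fin n → Fin n → ℤ, Function.Injective v → (Set.range v).ncard = n :=
      fun v hv => by
        rw [← Set.image_univ, Set.ncard_image_of_injective _ hv, Set.ncard_univ,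
          Nat.card_eq_fintype_card, Fintype.card_fin]
    have hcard : ∀ i, (r i).ncard = n := fun i => hrange _ (row_injective (hg.det_ne_zero i))
    have heq : r (f i) = r (f j) :=
      Set.eq_of_subset_of_ncard_le hsub (by rw [hcard, hcard]) (Set.finite_range _)
    rw [hf, hf] at heq
    exact Subtype.ext heq

/-- Every rational complete fan has a unimodular refinement with a strictly convex support
function. -/
theorem exists_unimodular_refining (S : PolyhedralFan n) (hrat : S.IsRational)
    (hcomplete : S.IsComplete) :
    ∃ (ι : Type) (_ : Finite ι) (g : ι → Matrix (Fin n) (Fin n) ℤ),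
      IsConvexFan g ∧ (∀ i, (g i).det.natAbs = 1) ∧
      (∀ i j, (∀ k, ∃ l, g j l = g i k) → i = j) ∧
      ∀ i, ∃ C ∈ S.cones, ∀ k, latticeHom n (g i k) ∈ C := by
  obtain ⟨ι, _, g, hg, hS⟩ := exists_isConvexFan_refining S hrat hcomplete
  obtain ⟨ι', _, g', hg', hfiner, hdet⟩ := exists_finer_natAbs_det_eq_one hg
  obtain ⟨ι'', hfin, f, hf, hinj⟩ := exists_finer_injective hg'
  refine ⟨ι'', hfin, _, hf, fun i => hdet _, hinj, fun i => ?_⟩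
  obtain ⟨j, hj⟩ := hfiner (f i)
  obtain ⟨C, hC, hCj⟩ := hS j
  refine ⟨C, hC, fun k => ?_⟩
  rw [← sum_coords (hg.det_ne_zero j) (latticeHom n (g' (f i) k))]
  exact Submodule.sum_mem _ fun l _ => C.smul_mem (hj k l) (hCj l)

/-! ### Subdividing every maximal cone by a pattern -/

section substitution
variable {ι κ : Type}

/-- The cones obtained by subdividing each cone of `g` according to the pattern `P`, a family of
cones that subdivides the nonnegative orthant. -/
def substGen (g : ι → Matrix (Fin n) (Fin n) ℤ) (P : κ → Matrix (Fin n) (Fin n) ℤ) (p : ι × κ) :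
    Matrix (Fin n) (Fin n) ℤ :=
  P p.2 * g p.1

theorem substGen_row (g : ι → Matrix (Fin n) (Fin n) ℤ) (P : κ → Matrix (Fin n) (Fin n) ℤ)
    (p : ι × κ) (k : Fin n) : substGen g P p k = P p.2 k ᵥ* g p.1 :=
  mul_apply_eq_vecMul _ _ _

theorem coords_mul (A B : Matrix (Fin n) (Fin n) ℤ) (x : Fin n → ℝ) :
    coords (A * B) x = coords A (coords B x) := by
  have h : (A * B).map (Int.cast : ℤ → ℝ) =
      A.map (Int.cast : ℤ → ℝ) * B.map (Int.cast : ℤ → ℝ) :=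
    Matrix.map_mul (f := Int.castRingHom ℝ)
  simp only [coords, vecMulLinear_apply, h, Matrix.mul_inv_rev, vecMul_vecMul]

/-- The pattern functional is added to the old vertex with a small weight. It has height zero at the
corners and `hrow` allows no other ray on the boundary, so the added functions agree on common faces
of old cones. -/
theorem isConvexFan_substGen [Finite ι] [Finite κ] {g : ι → Matrix (Fin n) (Fin n) ℤ}
    {P : κ → Matrix (Fin n) (Fin n) ℤ} {z : κ → Fin n → ℤ} (hg : IsConvexFan g)
    (hinj : ∀ i j, (∀ k, ∃ l, g j l = g i k) → i = j)
    (hP : ∀ t, (P t).det ≠ 0) (hcover : ∀ x : Fin n → ℝ, 0 ≤ x → ∃ t, 0 ≤ coords (P t) x)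
    (hz₁ : ∀ s t k l, P t k = P s l → z s ⬝ᵥ P t k = z t ⬝ᵥ P t k)
    (hz₂ : ∀ s t k, (∀ l, P s l ≠ P t k) → z s ⬝ᵥ P t k < z t ⬝ᵥ P t k)
    (hrow : ∀ t k, (∃ m, P t k = Pi.single m 1) ∨ ∀ m, 0 < P t k m)
    (hcorner₁ : ∀ t l m, P t l = Pi.single m 1 → z t m = 0)
    (hcorner₂ : ∀ t m, (∀ l, P t l ≠ Pi.single m 1) → z t m < 0) :
    IsConvexFan (substGen g P) := by
  have hdet := hg.det_ne_zero
  have hdet' : ∀ p, (substGen g P p).det ≠ 0 := fun p => by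
    rw [substGen, det_mul]
    exact mul_ne_zero (hP _) (hdet _)
  refine ⟨hdet', fun x => ?_, ?_⟩
  · obtain ⟨i, hi⟩ := hg.cover x
    obtain ⟨t, ht⟩ := hcover _ hi
    exact ⟨(i, t), by rwa [substGen, coords_mul]⟩
  obtain ⟨y, h1, h2⟩ := hg.convex
  let y' : ℝ → ι × κ → Fin n → ℝ := fun ε p =>
    y p.1 + ε • fun m => latticeHom n (z p.2) ⬝ᵥ coords (g p.1) (Pi.single m 1)
  have hy' : ∀ ε p x, y' ε p ⬝ᵥ x =
      y p.1 ⬝ᵥ x + ε * (latticeHom n (z p.2) ⬝ᵥ coords (g p.1) x) := fun ε p x => by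
    have : (fun m => latticeHom n (z p.2) ⬝ᵥ coords (g p.1) (Pi.single m 1)) ⬝ᵥ x =
        latticeHom n (z p.2) ⬝ᵥ coords (g p.1) x := by
      conv_rhs => rw [pi_eq_sum_univ' x]
      simp only [map_sum, map_smul, dotProduct_sum, dotProduct_smul]
      simp [dotProduct, mul_comm]
    simp only [y', add_dotProduct, smul_dotProduct, smul_eq_mul, this]
  have hev : ∀ (a b c d : ℝ), a < c → ∀ᶠ ε in 𝓝[>] (0 : ℝ), a + ε * b < c + ε * d :=
    fun a b c d hac => by
      have hl : ∀ a b : ℝ, Tendsto (fun ε : ℝ => a + ε * b) (𝓝[>] 0) (𝓝 (a + 0 * b)) := fun a b =>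
        ((continuous_const.add (continuous_id.mul continuous_const)).tendsto 0).mono_left
          nhdsWithin_le_nhds
      exact (hl a b).eventually_lt (hl c d) (by simpa using hac)
  have e1 : ∀ᶠ ε in 𝓝[>] (0 : ℝ), ∀ p q k,
      y q.1 ⬝ᵥ latticeHom n (substGen g P p k) < y p.1 ⬝ᵥ latticeHom n (substGen g P p k) →
      y' ε q ⬝ᵥ latticeHom n (substGen g P p k) < y' ε p ⬝ᵥ latticeHom n (substGen g P p k) := by
    simp only [eventually_all, hy']
    exact fun p q k h => hev _ _ _ _ h
  obtain ⟨ε, he1, hε⟩ := (e1.and self_mem_nhdsWithin).exists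
  replace hε : 0 < ε := hε
  have hPnonneg : ∀ t k, 0 ≤ latticeHom n (P t k) := fun t k m => by
    rw [latticeHom_apply]
    refine Int.cast_nonneg ?_
    rcases hrow t k with ⟨r, hr⟩ | h
    · rw [hr]
      exact (Pi.single_nonneg.2 zero_le_one : (0 : Fin n → ℤ) ≤ Pi.single r 1) m
    · exact (h m).le
  have hcoords : ∀ p k, coords (g p.1) (latticeHom n (substGen g P p k)) = latticeHom n (P p.2 k) :=
    fun p k => by rw [substGen_row, coords_latticeHom_vecMul (hdet _)]
  have key : ∀ p q k,
      ((∃ l, substGen g P q l = substGen g P p k) →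
        y' ε q ⬝ᵥ latticeHom n (substGen g P p k) = y' ε p ⬝ᵥ latticeHom n (substGen g P p k)) ∧
      ((∀ l, substGen g P q l ≠ substGen g P p k) →
        y' ε q ⬝ᵥ latticeHom n (substGen g P p k) < y' ε p ⬝ᵥ latticeHom n (substGen g P p k)) := by
    intro p q k
    set v := substGen g P p k with hv
    have hvp : 0 ≤ coords (g p.1) (latticeHom n v) := by
      rw [hcoords]
      exact hPnonneg _ _
    -- For small `ε` a strict inequality between the old vertices decides. Only ties are left to the
    -- pattern.
    by_cases hlt : y q.1 ⬝ᵥ latticeHom n v < y p.1 ⬝ᵥ latticeHom n v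
    · refine ⟨fun ⟨l, hl⟩ => absurd hlt (not_lt.2 (dotProduct_le hdet h1 h2 _ ?_)),
        fun _ => he1 p q k hlt⟩
      rw [← hl, hcoords]
      exact hPnonneg _ _
    have heq : y q.1 ⬝ᵥ latticeHom n v = y p.1 ⬝ᵥ latticeHom n v :=
      le_antisymm (dotProduct_le hdet h1 h2 _ hvp) (not_lt.1 hlt)
    have hrows := exists_row_of_dotProduct_eq hdet h1 h2 hvp heq
    rw [hcoords] at hrows
    rw [hy', hy', heq, hcoords]
    by_cases hpq : p.1 = q.1
    · have hrow_iff : ∀ l, substGen g P q l = v ↔ P q.2 l = P p.2 k := fun l => by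
        rw [hv, substGen_row, substGen_row, ← hpq]
        exact (vecMul_injective_of_det_ne_zero (hdet p.1)).eq_iff
      rw [← hpq, hcoords, latticeHom_dotProduct, latticeHom_dotProduct]
      refine ⟨fun ⟨l, hl⟩ => ?_, fun h => ?_⟩
      · rw [hz₁ _ _ _ _ ((hrow_iff l).1 hl).symm]
      · have := hz₂ q.2 p.2 k fun l hl => h l ((hrow_iff l).2 hl)
        have h3 : ((z q.2 ⬝ᵥ P p.2 k : ℤ) : ℝ) < ((z p.2 ⬝ᵥ P p.2 k : ℤ) : ℝ) := by
          exact_mod_cast this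
        exact add_lt_add_right (mul_lt_mul_of_pos_left h3 hε) _
    -- A tie between different old cones. If `v` is an old ray, it is a ray of both cones, and the
    -- corner conditions compare the values. An interior `v` would force the two cones to have the
    -- same generators, against `hinj`.
    · rcases hrow p.2 k with ⟨m, hm⟩ | hpos
      · have hvm : v = g p.1 m := by
          rw [hv, substGen_row, hm, single_one_vecMul]
          rfl
        obtain ⟨r, hr⟩ := hrows m (by simp [hm, latticeHom_apply])
        have hsingle : ∀ (s : κ) (m : Fin n),
            latticeHom n (z s) ⬝ᵥ (Pi.single m 1 : Fin n → ℝ) = z s m := fun s m => by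
          rw [dotProduct_single, mul_one, latticeHom_apply]
        have hrow_iff : ∀ l, substGen g P q l = v ↔ P q.2 l = Pi.single r 1 := fun l => by
          have : v = (Pi.single r 1 : Fin n → ℤ) ᵥ* g q.1 := by
            rw [hvm, ← hr, single_one_vecMul]
            rfl
          rw [this, substGen_row]
          exact (vecMul_injective_of_det_ne_zero (hdet q.1)).eq_iff
        have hq : coords (g q.1) (latticeHom n v) = Pi.single r 1 := by
          rw [hvm, ← hr, coords_row (hdet _)]
        rw [latticeHom_dotProduct, hm, hq, hsingle, dotProduct_single, mul_one,
          hcorner₁ _ _ _ hm]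
        refine ⟨fun ⟨l, hl⟩ => ?_, fun h => ?_⟩
        · rw [hcorner₁ _ _ _ ((hrow_iff l).1 hl)]
        · have := hcorner₂ q.2 r fun l hl => h l ((hrow_iff l).2 hl)
          have h3 : (z q.2 r : ℝ) < ((0 : ℤ) : ℝ) := by exact_mod_cast this
          exact add_lt_add_right (mul_lt_mul_of_pos_left h3 hε) _
      · refine absurd (hinj _ _ fun m => hrows m ?_) hpq
        rw [latticeHom_apply]
        exact_mod_cast hpos m
  exact ⟨y' ε, fun p q k l h => (key p q k).1 ⟨l, h.symm⟩, fun p q k h => (key p q k).2 h⟩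

end substitution

/-! ### The pattern and its finite verifications -/

section pattern

/-- The rays of the pattern: those of the nonnegative octant and ten interior ones. -/
def patternVertex : Fin 13 → Fin 3 → ℤ :=
  ![![1, 0, 0], ![0, 1, 0], ![0, 0, 1], ![1, 2, 2], ![2, 1, 2], ![2, 2, 1], ![1, 1, 1],
    ![2, 1, 1], ![1, 2, 1], ![1, 1, 2], ![3, 2, 2], ![2, 3, 2], ![2, 2, 3]]

/-- The maximal cones of the pattern. -/
def patternTriangle : Fin 21 → Fin 3 → Fin 13 :=
  ![![1, 2, 3], ![6, 4, 5], ![0, 7, 5], ![0, 4, 7], ![7, 10, 5], ![7, 4, 10], ![4, 5, 10],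
    ![2, 0, 4], ![6, 5, 3], ![1, 8, 3], ![1, 5, 8], ![8, 11, 3], ![8, 5, 11], ![5, 3, 11],
    ![0, 1, 5], ![6, 3, 4], ![2, 9, 4], ![2, 3, 9], ![9, 12, 4], ![9, 3, 12], ![3, 4, 12]]

/-- The values of a strictly convex support function of the pattern. -/
def patternHeight : Fin 13 → ℤ :=
  ![0, 0, 0, -33, -33, -33, -20, -23, -23, -23, -45, -45, -45]

/-- The linear functionals that agree with the support function on the maximal cones. -/
def patternFunctional : Fin 21 → Fin 3 → ℤ :=
  ![![-33, 0, 0], ![-6, -7, -7], ![0, -10, -13], ![0, -13, -10], ![-1, -10, -11],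
    ![-1, -11, -10], ![-3, -9, -9], ![0, -33, 0], ![-7, -6, -7], ![-13, 0, -10], ![-10, 0, -13],
    ![-11, -1, -10], ![-10, -1, -11], ![-9, -3, -9], ![0, 0, -33], ![-7, -7, -6], ![-10, -13, 0],
    ![-13, -10, 0], ![-10, -11, -1], ![-11, -10, -1], ![-9, -9, -3]]

/-- The generators of a maximal cone of the pattern. -/
def patternGen (t : Fin 21) : Matrix (Fin 3) (Fin 3) ℤ :=
  fun k => patternVertex (patternTriangle t k)

/-- The cross product, in a form suited to evaluation. -/
def cross (a b : Fin 3 → ℤ) : Fin 3 → ℤ :=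
  ![a 1 * b 2 - a 2 * b 1, a 2 * b 0 - a 0 * b 2, a 0 * b 1 - a 1 * b 0]

/-- The dual basis of the generators of a maximal cone of the pattern. -/
def patternDual (t : Fin 21) (k : Fin 3) : Fin 3 → ℤ :=
  -- The triple product is the determinant, which is `1` or `-1` and so equals its inverse:
  -- multiplying by it takes the place of the division in the dual basis.
  (patternGen t 0 ⬝ᵥ cross (patternGen t 1) (patternGen t 2)) •
    cross (patternGen t (k + 1)) (patternGen t (k + 2))

/-- An integral dual basis shows that the cones of the pattern are unimodular. -/
theorem patternDual_dotProduct :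
    ∀ t k l, patternDual t k ⬝ᵥ patternGen t l = if k = l then 1 else 0 := by
  decide +kernel

theorem patternFunctional_dotProduct_eq : ∀ t k,
    patternFunctional t ⬝ᵥ patternGen t k = patternHeight (patternTriangle t k) := by
  decide +kernel

theorem patternFunctional_dotProduct_lt : ∀ t w, (∀ k, patternTriangle t k ≠ w) →
    patternFunctional t ⬝ᵥ patternVertex w < patternHeight w := by
  decide +kernel

theorem patternVertex_injective : Function.Injective patternVertex := by
  have : ∀ v w, patternVertex v = patternVertex w → v = w := by decide +kernel
  exact this

/-- No ray lies in the relative interior of a two-dimensional face of the octant, so patterns in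
adjacent cones match. -/
theorem patternVertex_cases :
    ∀ w, (∃ m, patternVertex w = Pi.single m 1) ∨ ∀ m, 0 < patternVertex w m := by
  decide +kernel

theorem patternVertex_corner :
    ∀ m : Fin 3, ∃ w, patternVertex w = Pi.single m 1 ∧ patternHeight w = 0 := by
  decide +kernel

/-- The maximal cone of the pattern on the other side of a wall, if there is one. -/
def patternNeighbor : Fin 21 → Fin 3 → Fin 21 :=
  ![![17, 9, 0], ![6, 8, 15], ![4, 14, 3], ![5, 2, 7], ![6, 2, 5], ![6, 4, 3], ![4, 5, 1],
    ![3, 16, 7], ![13, 15, 1], ![11, 0, 10], ![12, 9, 14], ![13, 9, 12], ![13, 11, 10],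
    ![11, 12, 8], ![10, 2, 14], ![20, 1, 8], ![18, 7, 17], ![19, 16, 0], ![20, 16, 19],
    ![20, 18, 17], ![18, 19, 15]]

/-- A wall of the pattern is in the boundary of the octant, or else the functionals of the two
adjacent cones differ by a multiple of the coordinate that vanishes on the wall. -/
theorem patternDual_cases : ∀ t k, (∀ m, 0 ≤ patternDual t k m) ∨
    0 < (patternFunctional t - patternFunctional (patternNeighbor t k)) ⬝ᵥ patternGen t k ∧
      patternFunctional (patternNeighbor t k) = patternFunctional t -
        ((patternFunctional t - patternFunctional (patternNeighbor t k)) ⬝ᵥ patternGen t k) •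
          patternDual t k := by
  decide +kernel

/-- Every cone of the pattern at the ray `w` contains the ray `p` or the ray `q`. -/
def PatternCovers (w p q : Fin 13) : Prop :=
  ∀ t, (∃ k, patternTriangle t k = w) →
    (∃ k, patternTriangle t k = p) ∨ ∃ k, patternTriangle t k = q

instance (w p q : Fin 13) : Decidable (PatternCovers w p q) := by
  unfold PatternCovers
  infer_instance

theorem not_patternCovers_self : ∀ w p, p ≠ w → ¬ PatternCovers w p p := by
  decide +kernel

/-- Two rays can meet all cones around an interior ray only if it has at most four neighbours. The
three neighbours of `(1, 1, 1)` add up to five times it, and those of `(3, 2, 2)` to twice it. At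
`(2, 1, 1)` the opposite neighbours add up to twice it or to `(4, 3, 3)`. The remaining such cases
are cyclic permutations of these, and a unit vector is never a sum of several rays. -/
theorem patternVertex_add_ne : ∀ w p q, p ≠ w → q ≠ w → PatternCovers w p q →
    patternVertex p + patternVertex q ≠ patternVertex w ∧
    ∀ r, r ≠ w → PatternCovers w p r → PatternCovers w q r →
      patternVertex p + patternVertex q + patternVertex r ≠ patternVertex w := by
  decide +kernel

end pattern

section pattern

theorem patternGen_isUnit_det (t : Fin 21) : IsUnit (patternGen t).det := by
  have h : patternGen t * (Matrix.of (patternDual t))ᵀ = 1 := by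
    ext l k
    have := patternDual_dotProduct t k l
    rw [dotProduct_comm] at this
    rw [mul_apply, one_apply]
    simp only [eq_comm (a := l)]
    exact this
  exact isUnit_det_of_right_inverse h

theorem patternGen_det_ne_zero (t : Fin 21) : (patternGen t).det ≠ 0 :=
  (patternGen_isUnit_det t).ne_zero

theorem coords_patternGen (t : Fin 21) (x : Fin 3 → ℝ) (k : Fin 3) :
    coords (patternGen t) x k = latticeHom 3 (patternDual t k) ⬝ᵥ x := by
  rw [latticeHom_dotProduct_eq_sum (patternGen_det_ne_zero t)]
  simp [patternDual_dotProduct]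

/-- The cone is the one whose functional is largest at `x`. A negative coordinate of `x` would mean
that crossing the corresponding wall increases the value. -/
theorem patternGen_cover (x : Fin 3 → ℝ) (hx : 0 ≤ x) : ∃ t, 0 ≤ coords (patternGen t) x := by
  obtain ⟨t, ht⟩ := Finite.exists_max fun t => latticeHom 3 (patternFunctional t) ⬝ᵥ x
  refine ⟨t, fun k => ?_⟩
  rw [coords_patternGen]
  rcases patternDual_cases t k with h | ⟨hc, h⟩
  · refine dotProduct_nonneg_of_nonneg (fun m => ?_) hx
    rw [latticeHom_apply]
    exact Int.cast_nonneg (h m)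
  · have h1 := ht (patternNeighbor t k)
    rw [h, map_sub, latticeHom_smul, sub_dotProduct, smul_dotProduct, smul_eq_mul,
      sub_le_self_iff] at h1
    exact nonneg_of_mul_nonneg_right h1 (Int.cast_pos.2 hc)

theorem isConvexFan_substGen_patternGen {ι : Type} [Finite ι] {g : ι → Matrix (Fin 3) (Fin 3) ℤ}
    (hg : IsConvexFan g) (hinj : ∀ i j, (∀ k, ∃ l, g j l = g i k) → i = j) :
    IsConvexFan (substGen g patternGen) := by
  have hlt : ∀ t w, (∀ l, patternGen t l ≠ patternVertex w) →
      patternFunctional t ⬝ᵥ patternVertex w < patternHeight w := fun t w h =>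
    patternFunctional_dotProduct_lt t w fun k hk => h k (congrArg patternVertex hk)
  have hsingle : ∀ t w (m : Fin 3), patternVertex w = Pi.single m 1 →
      patternFunctional t ⬝ᵥ patternVertex w = patternFunctional t m := fun t w m h => by
    rw [h, dotProduct_single, mul_one]
  refine isConvexFan_substGen (z := patternFunctional) hg hinj patternGen_det_ne_zero
    patternGen_cover (fun s t k l h => ?_) (fun s t k h => ?_) (fun t k => patternVertex_cases _)
    (fun t l m h => ?_) (fun t m h => ?_)
  · rw [patternFunctional_dotProduct_eq, h, patternFunctional_dotProduct_eq]
    exact congrArg patternHeight (patternVertex_injective h.symm)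
  · rw [patternFunctional_dotProduct_eq]
    exact hlt s _ h
  · obtain ⟨w, hw, hw'⟩ := patternVertex_corner m
    have h1 := patternFunctional_dotProduct_eq t l
    rw [h, dotProduct_single, mul_one] at h1
    rw [h1, ← hw', patternVertex_injective (h.trans hw.symm)]
  · obtain ⟨w, hw, hw'⟩ := patternVertex_corner m
    have h1 := hlt t w fun l hl => h l (hl.trans hw)
    rwa [hsingle t w m hw, hw'] at h1

/-- No ray of a fan subdivided by the pattern is the sum of two or three rays such that any two of
them meet all maximal cones at the given ray. -/
theorem sum_ne_substGen_patternGen {ι : Type} {g : ι → Matrix (Fin 3) (Fin 3) ℤ}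
    (hg : ∀ i, (g i).det ≠ 0) (p : ι × Fin 21) (k : Fin 3) {m : ℕ} (h2 : 2 ≤ m) (h3 : m ≤ 3)
    (α : Fin m → Fin 3 → ℤ) (hα : ∀ a, α a ≠ substGen g patternGen p k)
    (hcov : ∀ a b, a ≠ b → ∀ q, (∃ l, substGen g patternGen q l = substGen g patternGen p k) →
      (∃ l, substGen g patternGen q l = α a) ∨ ∃ l, substGen g patternGen q l = α b) :
    ∑ a, α a ≠ substGen g patternGen p k := by
  have hinj := vecMul_injective_of_det_ne_zero (hg p.1)
  set w := patternTriangle p.2 k with hw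
  have hγ : substGen g patternGen p k = patternVertex w ᵥ* g p.1 := substGen_row _ _ _ _
  -- Only the cones inside the one old maximal cone `g p.1` are used; at a corner they form just a
  -- part of the star.
  have hcov' : ∀ a b, a ≠ b → ∀ t, (∃ k, patternTriangle t k = w) →
      (∃ l, patternVertex (patternTriangle t l) ᵥ* g p.1 = α a) ∨
      ∃ l, patternVertex (patternTriangle t l) ᵥ* g p.1 = α b := fun a b hab t ⟨k', hk'⟩ => by
    have := hcov a b hab (p.1, t) ⟨k', by
      rw [hγ, substGen_row, ← hk']
      rfl⟩
    simp only [substGen_row] at this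
    exact this
  -- If `α a` were not a ray of the pattern in this cone, another `α b` would lie in every cone of
  -- the pattern at `w`.
  have hmem : ∀ a, ∃ r, patternVertex r ᵥ* g p.1 = α a := fun a => by
    by_contra hne
    push Not at hne
    obtain ⟨b, hba⟩ : ∃ b : Fin m, b ≠ a := by
      have : Nontrivial (Fin m) := Fin.nontrivial_iff_two_le.2 h2
      exact exists_ne a
    have hb : ∀ t, (∃ k, patternTriangle t k = w) →
        ∃ l, patternVertex (patternTriangle t l) ᵥ* g p.1 = α b := fun t ht =>
      (hcov' a b hba.symm t ht).resolve_left fun ⟨l, hl⟩ => hne _ hl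
    obtain ⟨l, hl⟩ := hb p.2 ⟨k, rfl⟩
    refine not_patternCovers_self w (patternTriangle p.2 l) (fun h => hα b ?_) fun t ht => ?_
    · rw [hγ, ← hl, h]
    · obtain ⟨l', hl'⟩ := hb t ht
      exact Or.inl ⟨l', patternVertex_injective (hinj (hl'.trans hl.symm))⟩
  choose f hf using hmem
  have hfw : ∀ a, f a ≠ w := fun a h => hα a (by rw [hγ, ← hf, h])
  have hfc : ∀ a b, a ≠ b → PatternCovers w (f a) (f b) := fun a b hab t ht => by
    refine (hcov' a b hab t ht).imp ?_ ?_ <;> rintro ⟨l, hl⟩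
    · exact ⟨l, patternVertex_injective (hinj (hl.trans (hf a).symm))⟩
    · exact ⟨l, patternVertex_injective (hinj (hl.trans (hf b).symm))⟩
  rw [hγ]
  simp only [← hf]
  have hm : m = 2 ∨ m = 3 := by omega
  rcases hm with rfl | rfl
  · obtain ⟨h, -⟩ := patternVertex_add_ne w (f 0) (f 1) (hfw 0) (hfw 1) (hfc 0 1 (by decide))
    rw [Fin.sum_univ_two, ← add_vecMul]
    exact fun hs => h (hinj hs)
  · obtain ⟨-, h⟩ := patternVertex_add_ne w (f 0) (f 1) (hfw 0) (hfw 1) (hfc 0 1 (by decide))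
    have := h (f 2) (hfw 2) (hfc 0 2 (by decide)) (hfc 1 2 (by decide))
    rw [Fin.sum_univ_three, ← add_vecMul, ← add_vecMul]
    exact fun hs => this (hinj hs)

end pattern

/-! ### Faces and unimodularity of simplicial cones -/

/-- The cone generated by the rows of `A` with index in `I`. -/
def faceCone (A : Matrix (Fin n) (Fin n) ℤ) (I : Set (Fin n)) : PointedCone ℝ (Fin n → ℝ) :=
  PointedCone.hull ℝ (latticeHom n '' (A.row '' I))

section faceCone
variable {A : Matrix (Fin n) (Fin n) ℤ} {I J : Set (Fin n)}

theorem row_mem_faceCone {k : Fin n} (hk : k ∈ I) : latticeHom n (A k) ∈ faceCone A I :=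
  PointedCone.subset_hull ⟨_, ⟨k, hk, rfl⟩, rfl⟩

theorem faceCone_le {C : PointedCone ℝ (Fin n → ℝ)} (h : ∀ k ∈ I, latticeHom n (A k) ∈ C) :
    faceCone A I ≤ C := by
  refine Submodule.span_le.2 ?_
  rintro _ ⟨_, ⟨k, hk, rfl⟩, rfl⟩
  exact h k hk

theorem mem_faceCone (hA : A.det ≠ 0) {x : Fin n → ℝ} :
    x ∈ faceCone A I ↔ 0 ≤ coords A x ∧ ∀ k, coords A x k ≠ 0 → k ∈ I := by
  refine ⟨fun hx => ?_, fun ⟨h1, h2⟩ =>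
    mem_hull_of_coords hA h1 fun k hk => ⟨_, ⟨k, h2 k hk, rfl⟩, rfl⟩⟩
  induction hx using Submodule.span_induction with
  | mem x hx =>
    obtain ⟨_, ⟨k, hk, rfl⟩, rfl⟩ := hx
    have hc : coords A (latticeHom n (A.row k)) = Pi.single k 1 := coords_row hA k
    rw [hc]
    refine ⟨Pi.single_nonneg.2 zero_le_one, fun l hl => ?_⟩
    by_contra hlI
    have hlk : l ≠ k := fun h => hlI (h ▸ hk)
    exact hl (Pi.single_eq_of_ne hlk _)
  | zero => simp
  | add x y _ _ hx hy =>
    rw [map_add]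
    refine ⟨add_nonneg hx.1 hy.1, fun k hk => ?_⟩
    by_contra hkI
    have h1 := not_not.1 (mt (hx.2 k) hkI)
    have h2 := not_not.1 (mt (hy.2 k) hkI)
    exact hk (by rw [Pi.add_apply, h1, h2, add_zero])
  | smul c x _ hx =>
    have : coords A (c • x) = (c : ℝ) • coords A x := map_smul _ (c : ℝ) x
    rw [this]
    exact ⟨smul_nonneg c.2 hx.1, fun k hk => hx.2 k (right_ne_zero_of_mul hk)⟩

theorem mem_faceCone_univ (hA : A.det ≠ 0) {x : Fin n → ℝ} :
    x ∈ faceCone A Set.univ ↔ 0 ≤ coords A x := by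
  simp [mem_faceCone hA]

theorem faceCone_isFaceOf (hA : A.det ≠ 0) (hIJ : I ⊆ J) :
    (faceCone A I).IsFaceOf (faceCone A J) := by
  refine PointedCone.IsFaceOf.of_mem_of_add_mem_left
    (faceCone_le fun k hk => row_mem_faceCone (hIJ hk)) fun {x y} hx hy hxy => ?_
  rw [mem_faceCone hA] at hx hy hxy ⊢
  refine ⟨hx.1, fun k hk => hxy.2 k ?_⟩
  rw [map_add]
  exact (add_pos_of_pos_of_nonneg (lt_of_le_of_ne (hx.1 k) hk.symm) (hy.1 k)).ne'

theorem row_mem_of_isFaceOf (hA : A.det ≠ 0) {F : PointedCone ℝ (Fin n → ℝ)}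
    (hF : F.IsFaceOf (faceCone A I)) {x : Fin n → ℝ} (hx : x ∈ F) {k : Fin n}
    (hk : coords A x k ≠ 0) : latticeHom n (A k) ∈ F := by
  have hxI := (mem_faceCone hA).1 (hF.le hx)
  have h1 : ∀ l, coords A x l • latticeHom n (A l) ∈ faceCone A I := fun l => by
    by_cases hl : coords A x l = 0
    · rw [hl, zero_smul]
      exact zero_mem _
    · exact PointedCone.smul_mem _ (hxI.1 l) (row_mem_faceCone (hxI.2 l hl))
  have h2 := hF.mem_of_sum_mem h1 (by rwa [sum_coords hA]) k
  have h3 := F.smul_mem (inv_nonneg.2 (hxI.1 k)) h2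
  rwa [smul_smul, inv_mul_cancel₀ hk, one_smul] at h3

theorem eq_faceCone_of_isFaceOf (hA : A.det ≠ 0) {F : PointedCone ℝ (Fin n → ℝ)}
    (hF : F.IsFaceOf (faceCone A I)) : F = faceCone A {k | latticeHom n (A k) ∈ F} := by
  refine le_antisymm (fun x hx => ?_) (faceCone_le fun k hk => hk)
  exact (mem_faceCone hA).2 ⟨((mem_faceCone hA).1 (hF.le hx)).1,
    fun k hk => row_mem_of_isFaceOf hA hF hx hk⟩

theorem exists_vecMul_eq (hA : A.det.natAbs = 1) (z : Fin n → ℤ) : ∃ c : Fin n → ℤ, c ᵥ* A = z := by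
  have : Function.Surjective fun v : Fin n → ℤ => v ᵥ* A := by
    rw [vecMul_surjective_iff_isUnit, isUnit_iff_isUnit_det, Int.isUnit_iff_natAbs_eq]
    exact hA
  exact this z

theorem det_ne_zero_of_natAbs (hA : A.det.natAbs = 1) : A.det ≠ 0 := fun h => by
  rw [h] at hA
  simp at hA

theorem isPrimitive_row (hA : A.det.natAbs = 1) (k : Fin n) : IsPrimitive (A k) := by
  have hu : IsUnit A.det := Int.isUnit_iff_natAbs_eq.2 hA
  have h1 : ∑ j, A k j * A⁻¹ j k = 1 := by
    have := congrFun (congrFun (mul_nonsing_inv A hu) k) k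
    rwa [mul_apply, one_apply_eq] at this
  have h2 : Finset.univ.gcd (A k) ∣ 1 := by
    rw [← h1]
    exact Finset.dvd_sum fun j _ => (Finset.gcd_dvd (Finset.mem_univ j)).mul_right _
  rw [IsPrimitive, ← Finset.normalize_gcd, normalize_eq_one]
  exact isUnit_of_dvd_one h2

/-- A part of a lattice basis generates all lattice points of its span: their coordinates are
integral and vanish outside `I`. -/
theorem isUnimodularCone_faceCone (hA : A.det.natAbs = 1) (I : Set (Fin n)) :
    IsUnimodularCone (faceCone A I) := by
  classical
  have hdet := det_ne_zero_of_natAbs hA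
  cases nonempty_fintype I
  let e := (Fintype.equivFin I).symm
  have hrange : (Set.range fun j => A (e j)) = A.row '' I := by
    ext v
    constructor
    · rintro ⟨j, rfl⟩
      exact ⟨e j, (e j).2, rfl⟩
    · rintro ⟨k, hk, rfl⟩
      exact ⟨e.symm ⟨k, hk⟩, by simp [row]⟩
  refine ⟨Fintype.card I, fun j => A (e j), ⟨fun j => isPrimitive_row hA _,
    (linearIndependent_rows hdet).comp (fun j => (e j : Fin n))
      (Subtype.val_injective.comp e.injective), ?_⟩, ?_⟩
  · rw [faceCone, ← hrange, ← Set.range_comp]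
    rfl
  · rw [coneMultiplicity, AddSubgroup.relIndex_eq_one]
    intro z hz
    obtain ⟨c, rfl⟩ := exists_vecMul_eq hA z
    have hc : ∀ k, k ∉ I → c k = 0 := fun k hk => by
      have hle : Submodule.span ℝ (Set.range fun j => latticeHom n (A (e j))) ≤
          LinearMap.ker (LinearMap.proj k ∘ₗ coords A) := by
        refine Submodule.span_le.2 ?_
        rintro _ ⟨j, rfl⟩
        simp only [SetLike.mem_coe, LinearMap.mem_ker, LinearMap.comp_apply, LinearMap.proj_apply,
          coords_row hdet]
        have hkj : k ≠ e j := fun h => hk (h ▸ (e j).2)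
        exact Pi.single_eq_of_ne hkj _
      have h1 : coords A (latticeHom n (c ᵥ* A)) k = 0 := hle hz
      rw [coords_latticeHom_vecMul hdet, latticeHom_apply] at h1
      exact_mod_cast h1
    rw [vecMul_eq_sum]
    refine AddSubgroup.sum_mem _ fun k _ => ?_
    by_cases hk : k ∈ I
    · refine AddSubgroup.zsmul_mem _ (AddSubgroup.subset_closure ?_) _
      rw [hrange]
      exact ⟨k, hk, rfl⟩
    · rw [hc k hk, zero_smul]
      exact zero_mem _

theorem isFullDimCone_faceCone_univ (hA : A.det ≠ 0) : IsFullDimCone (faceCone A Set.univ) := by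
  refine eq_top_iff.2 fun x _ => ?_
  rw [← sum_coords hA x]
  exact Submodule.sum_mem _ fun k _ => Submodule.smul_mem _ _
    (Submodule.subset_span (row_mem_faceCone (Set.mem_univ k)))

end faceCone

/-! ### The polyhedral fan and its polytope -/

section fan
variable {ι : Type} {g : ι → Matrix (Fin n) (Fin n) ℤ}

theorem IsConvexFan.faceCone_support (hg : IsConvexFan g) {i j : ι} {x : Fin n → ℝ}
    (hi : 0 ≤ coords (g i) x) (hj : 0 ≤ coords (g j) x) :
    faceCone (g i) {k | coords (g i) x k ≠ 0} = faceCone (g j) {k | coords (g j) x k ≠ 0} := by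
  have key : ∀ {i j : ι}, 0 ≤ coords (g i) x → 0 ≤ coords (g j) x →
      faceCone (g i) {k | coords (g i) x k ≠ 0} ≤ faceCone (g j) {k | coords (g j) x k ≠ 0} :=
    fun {i j} hi hj => faceCone_le fun k hk => by
      obtain ⟨l, hl, hl'⟩ := hg.exists_row_of_ne hi hj hk
      rw [← hl]
      refine row_mem_faceCone ?_
      change coords (g j) x l ≠ 0
      rw [hl']
      exact hk
  exact le_antisymm (key hi hj) (key hj hi)

theorem IsConvexFan.faceCone_inf (hg : IsConvexFan g) (i j : ι) (I J : Set (Fin n)) :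
    faceCone (g i) I ⊓ faceCone (g j) J =
      faceCone (g i) (I ∩ {k | ∃ l ∈ J, g j l = g i k}) := by
  refine le_antisymm (fun x hx => ?_) (le_inf ?_ ?_)
  · have h1 := (mem_faceCone (hg.det_ne_zero i)).1 hx.1
    have h2 := (mem_faceCone (hg.det_ne_zero j)).1 hx.2
    refine (mem_faceCone (hg.det_ne_zero i)).2 ⟨h1.1, fun k hk => ⟨h1.2 k hk, ?_⟩⟩
    obtain ⟨l, hl, hl'⟩ := hg.exists_row_of_ne h1.1 h2.1 hk
    exact ⟨l, h2.2 l (hl' ▸ hk), hl⟩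
  · exact faceCone_le fun k hk => row_mem_faceCone hk.1
  · refine faceCone_le ?_
    rintro k ⟨-, l, hl, hlk⟩
    rw [← hlk]
    exact row_mem_faceCone hl

/-- The fan with maximal cones given by `g`. -/
def IsConvexFan.toFan [Finite ι] (hg : IsConvexFan g) : PolyhedralFan n where
  cones := Set.range fun p : ι × Set (Fin n) => faceCone (g p.1) p.2
  finite := Set.finite_range _
  nonempty := by
    obtain ⟨i, -⟩ := hg.cover 0
    exact ⟨_, (i, ∅), rfl⟩
  polyhedral := by
    rintro _ ⟨⟨i, I⟩, rfl⟩
    exact Submodule.fg_span ((I.toFinite.image _).image _)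
  face_mem := by
    rintro _ ⟨⟨i, I⟩, rfl⟩ F hF
    exact ⟨(i, _), (eq_faceCone_of_isFaceOf (hg.det_ne_zero i) hF).symm⟩
  inf_isFaceOf_left := by
    rintro _ ⟨⟨i, I⟩, rfl⟩ _ ⟨⟨j, J⟩, rfl⟩
    simp only [hg.faceCone_inf]
    exact faceCone_isFaceOf (hg.det_ne_zero i) Set.inter_subset_left
  inf_isFaceOf_right := by
    rintro _ ⟨⟨i, I⟩, rfl⟩ _ ⟨⟨j, J⟩, rfl⟩
    rw [inf_comm]
    simp only [hg.faceCone_inf]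
    exact faceCone_isFaceOf (hg.det_ne_zero j) Set.inter_subset_left

variable [Finite ι]

theorem IsConvexFan.toFan_isComplete (hg : IsConvexFan g) : hg.toFan.IsComplete := fun x => by
  obtain ⟨i, hi⟩ := hg.cover x
  exact ⟨_, ⟨(i, Set.univ), rfl⟩, (mem_faceCone_univ (hg.det_ne_zero i)).2 hi⟩

theorem IsConvexFan.toFan_isUnimodular (hg : IsConvexFan g) (hdet : ∀ i, (g i).det.natAbs = 1) :
    hg.toFan.IsUnimodular := by
  constructor
  · obtain ⟨i, -⟩ := hg.cover 0
    exact ⟨_, ⟨(i, Set.univ), rfl⟩, isFullDimCone_faceCone_univ (hg.det_ne_zero i)⟩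
  · rintro _ ⟨⟨i, I⟩, rfl⟩
    exact isUnimodularCone_faceCone (hdet i) I

theorem IsConvexFan.toFan_refines (hg : IsConvexFan g) {S : PolyhedralFan n}
    (h : ∀ i, ∃ C ∈ S.cones, ∀ k, latticeHom n (g i k) ∈ C) : hg.toFan.Refines S := by
  rintro _ ⟨⟨i, I⟩, rfl⟩
  obtain ⟨C, hC, hk⟩ := h i
  exact ⟨C, hC, faceCone_le fun k _ => hk k⟩

/-- The polytope is the convex hull of the `y i`. The normal cone of its face in direction `a` is
the cone of the fan that has `a` in its relative interior. -/
theorem IsConvexFan.toFan_isPolytopal (hg : IsConvexFan g) : hg.toFan.IsPolytopal := by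
  classical
  obtain ⟨y, h1, h2⟩ := hg.convex
  have hdet := hg.det_ne_zero
  let V : Finset (Fin n → ℝ) := (Set.finite_range y).toFinset
  let P : Set (Fin n → ℝ) := convexHull ℝ (V : Set (Fin n → ℝ))
  have hVP : ∀ i, y i ∈ P := fun i => subset_convexHull ℝ _ (by simp [V])
  have hbound : ∀ i x, 0 ≤ coords (g i) x → ∀ q ∈ P, x ⬝ᵥ q ≤ x ⬝ᵥ y i := fun i x hx => by
    have hconv : Convex ℝ {q : Fin n → ℝ | x ⬝ᵥ q ≤ x ⬝ᵥ y i} :=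
      convex_halfSpace_le ⟨fun a b => dotProduct_add _ _ _, fun c a => dotProduct_smul _ _ _⟩ _
    refine convexHull_min (fun q hq => ?_) hconv
    obtain ⟨j, rfl⟩ : ∃ j, y j = q := by simpa [V] using hq
    change x ⬝ᵥ y j ≤ x ⬝ᵥ y i
    rw [dotProduct_comm x, dotProduct_comm x]
    exact dotProduct_le hdet h1 h2 j hx
  have hface : ∀ i a, 0 ≤ coords (g i) a → y i ∈ faceInDirection P a := fun i a ha =>
    ⟨hVP i, fun q hq => by
      rw [dotProduct_sub, sub_nonneg]
      exact hbound i a ha q hq⟩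
  have hnormal : ∀ i a, 0 ≤ coords (g i) a →
      normalCone P (faceInDirection P a) = faceCone (g i) {k | coords (g i) a k ≠ 0} := by
    intro i a ha
    refine le_antisymm (fun b hb => ?_) (faceCone_le fun k hk p hp q hq => ?_)
    · -- the segment from `a` in direction `-b` starts in some maximal cone
      replace hb : ∀ p ∈ faceInDirection P a, ∀ q ∈ P, 0 ≤ b ⬝ᵥ (p - q) := hb
      -- As there are finitely many cones, one of them contains `a - ε • b` for arbitrarily small
      -- positive `ε`; its generators with a positive coefficient in `b` must then occur in `a`.
      obtain ⟨j, hj⟩ : ∃ j, ∃ᶠ ε in 𝓝[>] (0 : ℝ), 0 ≤ coords (g j) (a - ε • b) := by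
        by_contra hcon
        push Not at hcon
        obtain ⟨ε, hε⟩ := (eventually_all.2 hcon).exists
        obtain ⟨j, hj⟩ := hg.cover (a - ε • b)
        exact hε j hj
      have hcoord : ∀ ε k, coords (g j) (a - ε • b) k =
          coords (g j) a k - ε * coords (g j) b k := fun ε k => by
        rw [map_sub, map_smul]
        rfl
      have haj : 0 ≤ coords (g j) a := fun k => by
        have hlim : Tendsto (fun ε : ℝ => coords (g j) a k - ε * coords (g j) b k) (𝓝[>] 0)
            (𝓝 (coords (g j) a k - 0 * coords (g j) b k)) :=
          ((continuous_const.sub (continuous_id.mul continuous_const)).tendsto 0).mono_left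
            nhdsWithin_le_nhds
        rw [zero_mul, sub_zero] at hlim
        change 0 ≤ coords (g j) a k
        by_contra hneg
        obtain ⟨ε, hε1, hε2⟩ :=
          (hj.and_eventually (hlim.eventually (gt_mem_nhds (not_le.1 hneg)))).exists
        have := hε1 k
        rw [hcoord] at this
        exact absurd hε2 (not_lt.2 this)
      -- Since `y j` lies in the face in direction `a`, it also maximises `b`, so `b` lies in the
      -- `j`-th cone.
      have hbj : 0 ≤ coords (g j) b := by
        obtain ⟨k, hk⟩ := hg.cover b
        have h3 := hb _ (hface j a haj) _ (hVP k)
        rw [dotProduct_sub, sub_nonneg, dotProduct_comm b, dotProduct_comm b] at h3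
        exact coords_nonneg_of_support (hdet k) (hdet j) hk
          (exists_row_of_dotProduct_eq hdet h1 h2 hk (le_antisymm (dotProduct_le hdet h1 h2 j hk) h3))
      obtain ⟨ε, hε1, hε2⟩ := (hj.and_eventually self_mem_nhdsWithin).exists
      rw [hg.faceCone_support ha haj]
      refine (mem_faceCone (hdet j)).2 ⟨hbj, fun k hk => ?_⟩
      have h3 := hε1 k
      rw [hcoord] at h3
      replace h3 : 0 ≤ coords (g j) a k - ε * coords (g j) b k := h3
      have h4 : 0 < ε * coords (g j) b k := mul_pos hε2 (lt_of_le_of_ne (hbj k) hk.symm)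
      exact (h4.trans_le (sub_nonneg.1 h3)).ne'
    · rw [dotProduct_sub, sub_nonneg]
      have hin : ∀ l, 0 ≤ coords (g i) (latticeHom n (g i l)) := fun l => by
        rw [coords_row (hdet i)]
        exact Pi.single_nonneg.2 zero_le_one
      have hp1 : a ⬝ᵥ y i ≤ a ⬝ᵥ p := by
        have := hp.2 _ (hVP i)
        rwa [dotProduct_sub, sub_nonneg] at this
      have hle : ∀ l, coords (g i) a l * (latticeHom n (g i l) ⬝ᵥ p) ≤
          coords (g i) a l * (latticeHom n (g i l) ⬝ᵥ y i) := fun l =>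
        mul_le_mul_of_nonneg_left (hbound i _ (hin l) p hp.1) (ha l)
      have hexp : ∀ q, a ⬝ᵥ q = ∑ l, coords (g i) a l * (latticeHom n (g i l) ⬝ᵥ q) := fun q => by
        rw [dotProduct_comm, dotProduct_eq_sum_coords (hdet i)]
        simp only [dotProduct_comm q]
      rw [hexp, hexp] at hp1
      -- Equality of the sums forces equality in each term, so `p` also maximises every generator
      -- that occurs in `a`.
      have heq := (Finset.sum_eq_sum_iff_of_le fun l _ => hle l).1
        (le_antisymm (Finset.sum_le_sum fun l _ => hle l) hp1) k (Finset.mem_univ k)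
      rw [mul_left_cancel₀ hk heq]
      exact hbound i _ (hin k) q hq
  refine ⟨V, ?_, Set.eq_of_subset_of_subset ?_ ?_⟩
  · obtain ⟨i, -⟩ := hg.cover 0
    exact ⟨y i, by simp [V]⟩
  · rintro _ ⟨⟨i, I⟩, rfl⟩
    let c : Fin n → ℝ := fun k => if k ∈ I then 1 else 0
    have hc : coords (g i) (∑ k, c k • latticeHom n (g i k)) = c := coords_sum (hdet i) c
    refine ⟨∑ k, c k • latticeHom n (g i k), (hnormal i _ ?_).trans ?_⟩
    · rw [hc]
      intro k
      change 0 ≤ if k ∈ I then (1 : ℝ) else 0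
      split_ifs <;> norm_num
    · rw [hc]
      simp [c]
  · rintro _ ⟨a, rfl⟩
    obtain ⟨i, hi⟩ := hg.cover a
    exact ⟨(i, _), (hnormal i a hi).symm⟩

end fan

/-! ### Lattice points of unimodular cones -/

section generators
variable {m : ℕ} {α : Fin m → Fin n → ℤ} {C : PointedCone ℝ (Fin n → ℝ)}

theorem IsPrimitiveGenerators.coeff_injective (h : IsPrimitiveGenerators α C) {c d : Fin m → ℝ}
    (hcd : ∑ a, c a • latticeHom n (α a) = ∑ a, d a • latticeHom n (α a)) : c = d :=
  h.linearIndependent.fintypeLinearCombination_injective (by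
    simpa only [Fintype.linearCombination_apply] using hcd)

theorem latticeHom_sum_smul (c : Fin m → ℤ) (α : Fin m → Fin n → ℤ) :
    latticeHom n (∑ a, c a • α a) = ∑ a, (c a : ℝ) • latticeHom n (α a) := by
  rw [map_sum]
  exact Finset.sum_congr rfl fun a _ => latticeHom_smul _ _

theorem IsPrimitiveGenerators.intCoeff_injective (h : IsPrimitiveGenerators α C)
    {c d : Fin m → ℤ} (hcd : ∑ a, c a • α a = ∑ a, d a • α a) : c = d := by
  have h1 := congrArg (latticeHom n) hcd
  rw [latticeHom_sum_smul, latticeHom_sum_smul] at h1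
  funext a
  exact_mod_cast congrFun (h.coeff_injective h1) a

theorem IsPrimitiveGenerators.mem (h : IsPrimitiveGenerators α C) (a : Fin m) :
    latticeHom n (α a) ∈ C := by
  rw [← h.hull_eq]
  exact PointedCone.subset_hull ⟨a, rfl⟩

theorem IsPrimitiveGenerators.exists_coeff (h : IsPrimitiveGenerators α C) {x : Fin n → ℝ}
    (hx : x ∈ C) : ∃ c : Fin m → ℝ, 0 ≤ c ∧ ∑ a, c a • latticeHom n (α a) = x := by
  rw [← h.hull_eq] at hx
  obtain ⟨c, hc⟩ := (Submodule.mem_span_range_iff_exists_fun _).1 hx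
  exact ⟨fun a => (c a : ℝ), fun a => (c a).2, hc⟩

/-- Simplicial cones are pointed. Hence the zero cone belongs to the fan, and the ray of the centre
is a cone of the blow-up. -/
theorem IsPrimitiveGenerators.bot_isFaceOf (h : IsPrimitiveGenerators α C) :
    (⊥ : PointedCone ℝ (Fin n → ℝ)).IsFaceOf C := by
  refine PointedCone.IsFaceOf.of_mem_of_add_mem_left bot_le fun {x y} hx hy hxy => ?_
  obtain ⟨c, hc, rfl⟩ := h.exists_coeff hx
  obtain ⟨d, hd, rfl⟩ := h.exists_coeff hy
  rw [Submodule.mem_bot] at hxy ⊢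
  rw [← Finset.sum_add_distrib] at hxy
  simp only [← add_smul] at hxy
  have h0 : (fun a => c a + d a) = 0 := h.coeff_injective (by simpa using hxy)
  refine Finset.sum_eq_zero fun a _ => ?_
  have h1 : c a + d a = 0 := congrFun h0 a
  have h2 : c a = 0 := le_antisymm (by linarith [show 0 ≤ d a from hd a]) (hc a)
  rw [h2, zero_smul]

/-- The lattice points of a unimodular cone are the nonnegative integral combinations of its
generators. -/
theorem IsUnimodularGenerators.exists_intCoeff (h : IsUnimodularGenerators α C) {z : Fin n → ℤ}
    (hz : latticeHom n z ∈ C) : ∃ c : Fin m → ℤ, 0 ≤ c ∧ ∑ a, c a • α a = z := by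
  obtain ⟨d, hd, hdz⟩ := h.1.exists_coeff hz
  have hclosure : z ∈ AddSubgroup.closure (Set.range α) := by
    refine AddSubgroup.relIndex_eq_one.1 h.2 ?_
    change latticeHom n z ∈ Submodule.span ℝ (Set.range fun i => latticeHom n (α i))
    rw [← hdz]
    exact Submodule.sum_mem _ fun a _ => Submodule.smul_mem _ _ (Submodule.subset_span ⟨a, rfl⟩)
  rw [← Submodule.span_int_eq_addSubgroupClosure, Submodule.mem_toAddSubgroup,
    Submodule.mem_span_range_iff_exists_fun] at hclosure
  obtain ⟨c, hc⟩ := hclosure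
  refine ⟨c, fun a => ?_, hc⟩
  rw [← hc, latticeHom_sum_smul] at hdz
  have h1 : d a = (c a : ℝ) := congrFun (h.1.coeff_injective hdz) a
  have h2 : (0 : ℝ) ≤ c a := h1 ▸ hd a
  exact_mod_cast h2

theorem IsPrimitiveGenerators.ne_sum (h : IsPrimitiveGenerators α C) (hm : 2 ≤ m) (a : Fin m) :
    α a ≠ ∑ b, α b := fun hne => by
  obtain ⟨b, hb⟩ : ∃ b : Fin m, b ≠ a := by
    have : Nontrivial (Fin m) := Fin.nontrivial_iff_two_le.2 hm
    exact exists_ne a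
  have h1 : ∑ b, (Pi.single a 1 : Fin m → ℤ) b • α b = ∑ b, (1 : Fin m → ℤ) b • α b := by
    simpa [Pi.single_apply] using hne
  have := congrFun (h.intCoeff_injective h1) b
  simp [hb] at this

end generators

/-! ### Combinatorics of a blow-up around its centre -/

section blowUp
variable {ι : Type} {g : ι → Matrix (Fin n) (Fin n) ℤ}

/-- The center of a blow-up is one of its rays. -/
theorem exists_row_eq_sum [Finite ι] (hg : IsConvexFan g) (hdet : ∀ i, (g i).det.natAbs = 1)
    {R : PolyhedralFan n} {m : ℕ} (hm : 2 ≤ m) {α : Fin m → Fin n → ℤ}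
    {C : PointedCone ℝ (Fin n → ℝ)} (hC : C ∈ R.cones) (hα : IsUnimodularGenerators α C)
    (hT : hg.toFan.cones = R.stellarCones (latticeHom n (∑ a, α a))) :
    ∃ i k, g i k = ∑ a, α a := by
  set γ := latticeHom n (∑ a, α a) with hγ
  have hsum : γ = ∑ a, ((1 : ℤ) : ℝ) • latticeHom n (α a) := by
    rw [hγ, ← latticeHom_sum_smul]
    simp only [one_smul]
  have hγC : γ ∈ C := by
    rw [hsum]
    exact Submodule.sum_mem _ fun a _ => C.smul_mem (by simp) (hα.1.mem a)
  have a₀ : Fin m := ⟨0, by omega⟩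
  have hγ0 : γ ≠ 0 := fun h0 => by
    have h1 : ∑ a, ((1 : ℤ) : ℝ) • latticeHom n (α a) =
        ∑ a, (0 : Fin m → ℝ) a • latticeHom n (α a) := by
      rw [← hsum, h0]
      simp
    have := congrFun (hα.1.coeff_injective h1) a₀
    simp at this
  have hD : PointedCone.hull ℝ (insert γ ((⊥ : PointedCone ℝ (Fin n → ℝ)) : Set (Fin n → ℝ))) ∈
      hg.toFan.cones := by
    rw [hT]
    exact Or.inr ⟨⊥, R.face_mem C hC _ hα.1.bot_isFaceOf, by simpa using hγ0,
      ⟨C, hC, bot_le, hγC⟩, rfl⟩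
  obtain ⟨⟨i, I⟩, hiI⟩ := hD
  replace hiI : faceCone (g i) I = PointedCone.hull ℝ
    (insert γ ((⊥ : PointedCone ℝ (Fin n → ℝ)) : Set (Fin n → ℝ))) := hiI
  have hγI : γ ∈ faceCone (g i) I := hiI ▸ PointedCone.subset_hull (Set.mem_insert _ _)
  have hγI' := (mem_faceCone (hg.det_ne_zero i)).1 hγI
  obtain ⟨k, hk⟩ : ∃ k, coords (g i) γ k ≠ 0 := by
    by_contra hcon
    push Not at hcon
    exact hγ0 (coords_injective (hg.det_ne_zero i) (by rw [map_zero]; exact funext hcon))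
  have hrow : latticeHom n (g i k) ∈ faceCone (g i) I := row_mem_faceCone (hγI'.2 k hk)
  obtain ⟨t, ht⟩ : ∃ t : ℝ, 0 ≤ t ∧ latticeHom n (g i k) = t • γ := by
    rw [hiI] at hrow
    obtain ⟨t, z, hz, hzt⟩ := Submodule.mem_span_insert.1 hrow
    rw [Submodule.span_eq, Submodule.mem_bot] at hz
    rw [hz, add_zero] at hzt
    exact ⟨t, t.2, hzt⟩
  obtain ⟨c, hc0, hc⟩ := hα.exists_intCoeff (z := g i k) (ht.2 ▸ C.smul_mem ht.1 hγC)
  have hct : ∀ a, (c a : ℝ) = t := fun a => by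
    refine congrFun (hα.1.coeff_injective (c := fun a => (c a : ℝ)) (d := fun _ => t) ?_) a
    rw [← latticeHom_sum_smul, hc, ht.2, hsum, Finset.smul_sum]
    simp
  obtain ⟨d, hd⟩ := exists_vecMul_eq (hdet i) (∑ a, α a)
  -- The generator is `t` times `γ` with `t` a nonnegative integer. Since `γ` is integral in the
  -- basis of rows, `t` divides one.
  have hcd : c a₀ * d k = 1 := by
    have h1 := congrFun (coords_row (hg.det_ne_zero i) k) k
    rw [ht.2, map_smul, hγ, ← hd, coords_latticeHom_vecMul (hg.det_ne_zero i),
      Pi.single_eq_same, ← hct a₀] at h1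
    have h2 : (c a₀ : ℝ) * (d k : ℝ) = 1 := h1
    exact_mod_cast h2
  have hc1 : c a₀ = 1 := Int.eq_one_of_mul_eq_one_right (hc0 a₀) hcd
  refine ⟨i, k, latticeHom_injective ?_⟩
  rw [ht.2, ← hct a₀, hc1, Int.cast_one, one_smul]

/-- In a blow-up, every maximal cone at the new ray contains all but at most one of the generators
of the cone that has been subdivided. -/
theorem exists_row_eq_or [Finite ι] (hg : IsConvexFan g) (hdet : ∀ i, (g i).det.natAbs = 1)
    {R : PolyhedralFan n} {m : ℕ} {α : Fin m → Fin n → ℤ}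
    {C : PointedCone ℝ (Fin n → ℝ)} (hC : C ∈ R.cones) (hα : IsUnimodularGenerators α C)
    (hT : hg.toFan.cones = R.stellarCones (latticeHom n (∑ a, α a))) {j : ι} {l₀ : Fin n}
    (hl₀ : g j l₀ = ∑ a, α a) {a b : Fin m} (hab : a ≠ b) :
    (∃ l, g j l = α a) ∨ ∃ l, g j l = α b := by
  classical
  set γ := latticeHom n (∑ a, α a) with hγ
  have hdj := hg.det_ne_zero j
  let D := faceCone (g j) Set.univ
  have hγD : γ ∈ D := by
    rw [hγ, ← hl₀]
    exact row_mem_faceCone (Set.mem_univ l₀)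
  have hDT : D ∈ R.stellarCones γ := hT ▸ ⟨(j, Set.univ), rfl⟩
  -- As `D` contains `γ`, it is a new cone: `γ` joined to a cone `C₀`, both inside an old cone `C'`.
  rcases hDT with ⟨-, h⟩ | ⟨C₀, hC₀, hγC₀, ⟨C', hC', hC₀C', hγC'⟩, hD⟩
  · exact absurd hγD h
  have hC₀D : C₀ ≤ D := fun x hx => hD ▸ PointedCone.subset_hull (Set.mem_insert_of_mem _ hx)
  have hDC' : D ≤ C' := by
    rw [hD]
    exact Submodule.span_le.2 (Set.insert_subset hγC' hC₀C')
  have hC₀face : C₀.IsFaceOf C' := by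
    have := R.inf_isFaceOf_right C₀ hC₀ C' hC'
    rwa [inf_eq_left.2 hC₀C'] at this
  have hcγ : coords (g j) γ = Pi.single l₀ 1 := by rw [hγ, ← hl₀, coords_row hdj]
  have hDnonneg : ∀ x ∈ D, 0 ≤ coords (g j) x := fun x hx => (mem_faceCone_univ hdj).1 hx
  have hrows : ∀ l, l ≠ l₀ → latticeHom n (g j l) ∈ C₀ := fun l hl => by
    have h1 : latticeHom n (g j l) ∈ D := row_mem_faceCone (Set.mem_univ l)
    rw [hD] at h1
    obtain ⟨s, x, hx, hsx⟩ := Submodule.mem_span_insert.1 h1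
    rw [Submodule.span_eq] at hx
    replace hsx : latticeHom n (g j l) = (s : ℝ) • γ + x := hsx
    have h2 := congrFun (congrArg (coords (g j)) hsx) l₀
    rw [coords_row hdj, map_add, map_smul, hcγ, Pi.single_eq_of_ne hl.symm] at h2
    have h3 : (0 : ℝ) = s * (Pi.single l₀ 1 : Fin n → ℝ) l₀ + coords (g j) x l₀ := h2
    rw [Pi.single_eq_same, mul_one] at h3
    have h4 : 0 ≤ coords (g j) x l₀ := hDnonneg x (hC₀D hx) l₀
    have h5 : (s : ℝ) = 0 := le_antisymm (by linarith) s.2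
    rw [hsx, h5, zero_smul, zero_add]
    exact hx
  -- If the coordinate at `γ` were not positive, adding a suitable point of `D` would move `x` into
  -- the face `C₀` of `C'`, so `x` would lie in `C₀` already.
  have hpos : ∀ x ∈ C', x ∉ C₀ → 0 < coords (g j) x l₀ := fun x hx hxC₀ => by
    by_contra hneg
    rw [not_lt] at hneg
    refine hxC₀ ?_
    let N : ℝ := ∑ l, |coords (g j) x l|
    have hN : ∀ l, 0 ≤ coords (g j) x l + N := fun l => by
      have : |coords (g j) x l| ≤ N :=
        Finset.single_le_sum (f := fun l => |coords (g j) x l|) (fun l _ => abs_nonneg _)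
          (Finset.mem_univ l)
      linarith [neg_abs_le (coords (g j) x l)]
    have hN0 : 0 ≤ N := Finset.sum_nonneg fun l _ => abs_nonneg _
    let w := ∑ l, (if l = l₀ then -coords (g j) x l₀ else N) • latticeHom n (g j l)
    have hw : w ∈ D := Submodule.sum_mem _ fun l _ => by
      refine D.smul_mem ?_ (row_mem_faceCone (Set.mem_univ l))
      split_ifs
      exacts [neg_nonneg.2 hneg, hN0]
    refine hC₀face.mem_of_add_mem_left hx (hDC' hw) ?_
    have hxw : x + w = ∑ l, (if l = l₀ then 0 else coords (g j) x l + N) •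
        latticeHom n (g j l) := by
      conv_lhs => rw [← sum_coords hdj x]
      rw [← Finset.sum_add_distrib]
      refine Finset.sum_congr rfl fun l _ => ?_
      rw [← add_smul]
      congr 1
      split_ifs with h
      · rw [h, add_neg_cancel]
      · rfl
    rw [hxw]
    refine Submodule.sum_mem _ fun l _ => ?_
    split_ifs with h
    · rw [zero_smul]
      exact zero_mem _
    · exact C₀.smul_mem (hN l) (hrows l h)
  have hαC' : ∀ a, latticeHom n (α a) ∈ C' := fun a => by
    have hface := R.inf_isFaceOf_left C hC C' hC'
    have hmem : ∑ a, latticeHom n (α a) ∈ C ⊓ C' := by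
      rw [← map_sum]
      refine ⟨?_, hγC'⟩
      rw [map_sum]
      exact Submodule.sum_mem _ fun a _ => hα.1.mem a
    exact (hface.mem_of_sum_mem hα.1.mem hmem a).2
  have hCC' : C ≤ C' := by
    rw [← hα.1.hull_eq]
    refine Submodule.span_le.2 ?_
    rintro _ ⟨a, rfl⟩
    exact hαC' a
  have hCface : C.IsFaceOf C' := by
    have := R.inf_isFaceOf_right C hC C' hC'
    rwa [inf_eq_left.2 hCC'] at this
  have hCDface : (C ⊓ D).IsFaceOf D := by
    have := hCface.inf (PointedCone.IsFaceOf.refl D)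
    rwa [inf_eq_right.2 hDC'] at this
  choose e he using fun a => exists_vecMul_eq (hdet j) (α a)
  have hcα : ∀ a, coords (g j) (latticeHom n (α a)) = latticeHom n (e a) := fun a => by
    rw [← he a, coords_latticeHom_vecMul hdj]
  -- The coordinates of the `α a` at `γ` are nonnegative integers with sum one, so at most one of
  -- the `α a` lies outside `C₀`.
  have hesum : ∑ a, e a l₀ = 1 := by
    have h1 : coords (g j) γ l₀ = ∑ a, coords (g j) (latticeHom n (α a)) l₀ := by
      rw [hγ, map_sum, map_sum, Finset.sum_apply]
    rw [hcγ, Pi.single_eq_same] at h1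
    simp only [hcα, latticeHom_apply] at h1
    exact_mod_cast h1.symm
  have he0 : ∀ a, 0 ≤ e a l₀ := fun a => by
    have h1 : 0 ≤ coords (g j) (latticeHom n (α a)) l₀ := by
      by_cases h : latticeHom n (α a) ∈ C₀
      · exact hDnonneg _ (hC₀D h) l₀
      · exact (hpos _ (hαC' a) h).le
    rw [hcα, latticeHom_apply] at h1
    exact_mod_cast h1
  -- The rows of `D` that occur in `α a` lie in `C`, because `C ⊓ D` is a face of `D`. They are
  -- nonnegative integral combinations of the `α b`, among which `α a` is indecomposable, so one of
  -- these rows equals `α a`.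
  have hkey : ∀ a, latticeHom n (α a) ∈ C₀ → ∃ l, g j l = α a := fun a ha => by
    have haD := hC₀D ha
    have hea : ∀ l, 0 ≤ e a l := fun l => by
      have h1 := hDnonneg _ haD l
      rw [hcα] at h1
      have h2 : (0 : ℝ) ≤ (e a l : ℝ) := h1
      exact_mod_cast h2
    have hl : ∀ l, ∃ c : Fin m → ℤ, 0 ≤ c ∧ (e a l ≠ 0 → ∑ b, c b • α b = g j l) := fun l => by
      by_cases hel : e a l = 0
      · exact ⟨0, le_rfl, fun h => absurd hel h⟩
      · have h1 := row_mem_of_isFaceOf hdj hCDface ⟨hα.1.mem a, haD⟩ (k := l)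
          (by rw [hcα, latticeHom_apply]; exact_mod_cast hel)
        obtain ⟨c, hc0, hc⟩ := hα.exists_intCoeff h1.1
        exact ⟨c, hc0, fun _ => hc⟩
    choose c hc0 hc using hl
    have hsum : (fun b => ∑ l, e a l * c l b) = Pi.single a 1 := by
      refine hα.1.intCoeff_injective ?_
      have h1 : ∑ b, (Pi.single a 1 : Fin m → ℤ) b • α b = α a := by simp [Pi.single_apply]
      rw [h1, ← he a, vecMul_eq_sum]
      simp only [Finset.sum_smul]
      rw [Finset.sum_comm]
      refine Finset.sum_congr rfl fun l _ => ?_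
      simp only [mul_smul]
      rw [← Finset.smul_sum]
      by_cases hel : e a l = 0
      · rw [hel, zero_smul, zero_smul]
      · rw [hc l hel]
    have hnn : ∀ l b, 0 ≤ e a l * c l b := fun l b => mul_nonneg (hea l) (hc0 l b)
    have hsa : ∑ l, e a l * c l a = 1 := by simpa using congrFun hsum a
    obtain ⟨l, -, hla⟩ : ∃ l ∈ Finset.univ, e a l * c l a ≠ 0 := by
      refine Finset.exists_ne_zero_of_sum_ne_zero ?_
      rw [hsa]
      exact one_ne_zero
    have hla1 : e a l * c l a = 1 := by
      have h1 : e a l * c l a ≤ ∑ l, e a l * c l a :=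
        Finset.single_le_sum (fun l _ => hnn l a) (Finset.mem_univ l)
      have h2 : 0 < e a l * c l a := lt_of_le_of_ne (hnn l a) hla.symm
      omega
    have hcla : c l a = 1 := Int.eq_one_of_mul_eq_one_left (hc0 l a) hla1
    have hel : e a l ≠ 0 := left_ne_zero_of_mul hla
    have hclb : ∀ b, b ≠ a → c l b = 0 := fun b hb => by
      have h1 : ∑ l, e a l * c l b = 0 := by
        have := congrFun hsum b
        rwa [Pi.single_eq_of_ne hb] at this
      have h2 := (Finset.sum_eq_zero_iff_of_nonneg fun l _ => hnn l b).1 h1 l (Finset.mem_univ l)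
      exact (mul_eq_zero.1 h2).resolve_left hel
    refine ⟨l, ?_⟩
    rw [← hc l hel, Finset.sum_eq_single a (fun b _ hb => by rw [hclb b hb, zero_smul]) (by simp),
      hcla, one_smul]
  by_contra hcon
  rw [not_or] at hcon
  have h1 : ∀ a, (¬ ∃ l, g j l = α a) → 1 ≤ e a l₀ := fun a ha => by
    have h2 := hpos _ (hαC' a) fun h => ha (hkey a h)
    rw [hcα, latticeHom_apply] at h2
    exact_mod_cast h2
  have h2 : e a l₀ + e b l₀ ≤ ∑ a, e a l₀ := by
    rw [← Finset.sum_pair (f := fun a => e a l₀) hab]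
    exact Finset.sum_le_sum_of_subset_of_nonneg (Finset.subset_univ _) fun a _ _ => he0 a
  have := h1 a hcon.1
  have := h1 b hcon.2
  omega

end blowUp

/-- A fan subdivided by the pattern is not a blow-up. -/
theorem not_isBlowUp_substGen {ι : Type} [Finite ι] {g : ι → Matrix (Fin 3) (Fin 3) ℤ}
    (hg : ∀ i, (g i).det.natAbs = 1) (hfan : IsConvexFan (substGen g patternGen))
    (R : PolyhedralFan 3) : ¬ hfan.toFan.IsBlowUp R := by
  rintro ⟨C, hC, m, α, hm, hα, hT⟩
  have hdet : ∀ p, (substGen g patternGen p).det.natAbs = 1 := fun p => by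
    rw [substGen, det_mul, Int.natAbs_mul, hg, mul_one]
    exact Int.isUnit_iff_natAbs_eq.1 (patternGen_isUnit_det _)
  obtain ⟨p, k, hpk⟩ := exists_row_eq_sum hfan hdet hm hC hα hT
  have hm3 : m ≤ 3 := by
    simpa using hα.1.linearIndependent.fintype_card_le_finrank
  refine sum_ne_substGen_patternGen (fun i => det_ne_zero_of_natAbs (hg i)) p k hm hm3 α
    (fun a h => hα.1.ne_sum hm a (h.trans hpk)) (fun a b hab q ⟨l, hl⟩ => ?_) hpk.symm
  exact exists_row_eq_or hfan hdet hC hα hT (hl.trans hpk) hab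

end PolyhedralFan

theorem mainTheorem4 (S : PolyhedralFan 3) (hrat : S.IsRational) (hcomplete : S.IsComplete) :
    ∃ T : PolyhedralFan 3, T.IsUnimodular ∧ T.IsComplete ∧ T.Refines S ∧
      (∀ R : PolyhedralFan 3, R.IsUnimodular → ¬ T.IsBlowUp R) ∧
      (S.IsPolytopal → T.IsPolytopal) := by
  obtain ⟨ι, _, g, hg, hdet, hinj, hS⟩ :=
    PolyhedralFan.exists_unimodular_refining S hrat hcomplete
  have hfan := PolyhedralFan.isConvexFan_substGen_patternGen hg hinj
  refine ⟨hfan.toFan, hfan.toFan_isUnimodular fun p => ?_, hfan.toFan_isComplete,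
    hfan.toFan_refines fun p => ?_, fun R _ => PolyhedralFan.not_isBlowUp_substGen hdet hfan R,
    fun _ => hfan.toFan_isPolytopal⟩
  · rw [PolyhedralFan.substGen, Matrix.det_mul, Int.natAbs_mul, hdet, mul_one]
    exact Int.isUnit_iff_natAbs_eq.1 (PolyhedralFan.patternGen_isUnit_det _)
  · obtain ⟨C, hC, hk⟩ := hS p.1
    refine ⟨C, hC, fun k => ?_⟩
    rw [PolyhedralFan.substGen_row, PolyhedralFan.latticeHom_vecMul]
    refine Submodule.sum_mem _ fun l _ => C.smul_mem (Int.cast_nonneg ?_) (hk l)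
    rcases PolyhedralFan.patternVertex_cases (PolyhedralFan.patternTriangle p.2 k) with ⟨m, hm⟩ | h
    · have : PolyhedralFan.patternGen p.2 k = Pi.single m 1 := hm
      rw [this]
      exact (Pi.single_nonneg.2 zero_le_one : (0 : Fin 3 → ℤ) ≤ Pi.single m 1) l
    · exact (h l).le
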